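/- Let $N$ be a lattice (a finitely generated free abelian group) of rank $n$, let $\Delta$ be a complete nonsingular fan in $N\otimes_{\mathbb Z}\mathbb R$ (a finite fan whose cones cover $N\otimes_{\mathbb Z}\mathbb R$, each cone being generated by part of a $\mathbb Z$-basis of $N$), and let $X=X(\Delta)$ be the associated complete nonsingular toric variety over $\mathbb C$. For a cone $\sigma\in\Delta$ let $X(\sigma)$ be the corresponding toric subvariety of $X$, that is, the toric variety of the star $\Delta(\sigma)$, the fan in $N/\langle\sigma\rangle$ whose cones are the images of the cones of $\Delta$ containing $\sigma$, where $\langle\sigma\rangle$ is the sublattice generated by the ray generators of $\sigma$. A ray generator of $\Delta$ is the primitive lattice vector on a one-dimensional cone of $\Delta$. A set $\{\rho_1,\dots,\rho_k\}$ of distinct ray generators is called primitive if it does not generate a cone of $\Delta$ but, for every $j$, the set $\{\rho_1,\dots,\rho_k\}\smallsetminus\{\rho_j\}$ does. A nonsingular complete variety is called Fano if its anticanonical line bundle is ample. Then the following are equivalent. (i) $X$ is Fano, and every toric subvariety $X(\sigma)$, $\sigma\in\Delta$, is Fano. (ii) For every primitive set $\{\rho_1,\dots,\rho_k\}$, either $\rho_1+\cdots+\rho_k=0$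 or $\rho_1+\cdots+\rho_k=\rho'$ for some ray generator $\rho'$ of $\Delta$. (iii) For every maximal cone $\mu=\langle\rho_1,\dots,\rho_n\rangle$ of $\Delta$ and every ray generator $\rho$ of $\Delta$, if we write $\rho=b_1\rho_1+\cdots+b_n\rho_n$, then $-1\le b_j\le 1$ for $j=1,\dots,n$, and $b_j=1$ for at most one $j$. -/

import Mathlib

/-!
# Nonsingular fans, their toric varieties, and the Fano condition

A nonsingular toric variety over `ℂ` is built from its fan as a scheme, by gluing the affine charts
`Spec ℂ[σ^∨ ∩ M]`.  The Fano condition (ampleness of the anticanonical bundle) is defined for any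
integral scheme over `ℂ`, with no reference to fans.
-/

namespace ToricFano

open CategoryTheory CategoryTheory.Limits AlgebraicGeometry TensorProduct

/-! ## The Fano condition -/

section Canonical

variable (k K : Type) [Field k] [Field K] [Algebra k K]

/-- Rational top differential forms: the top exterior power of the Kähler differentials of the
function field `K` over `k`.  For the function field of a complex variety `X` one has
`dim_K Ω[K⁄k] = dim X`, and this is a one-dimensional `K`-vector space, the generic stalk of the
canonical sheaf of `X`. -/
abbrev RationalTopForm : Type :=
  ↥(⋀[K]^(Module.finrank K Ω[K⁄k]) Ω[K⁄k])

variable {K}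

/-- For a local ring `O ⊆ K` of a variety, the image of `⋀^n Ω[O⁄k]` in the rational top forms: the
`O`-module spanned by the forms `df₁ ∧ ⋯ ∧ dfₙ` with all `fᵢ ∈ O`.  At a nonsingular point this is
the stalk `ω_x` of the canonical sheaf. -/
noncomputable def regularTopForms (O : Subring K) : Submodule O (RationalTopForm k K) :=
  Submodule.span O {ω | ∃ f : Fin (Module.finrank K Ω[K⁄k]) → K, (∀ i, f i ∈ O) ∧
    ω = exteriorPower.ιMulti K _ (fun i => KaehlerDifferential.D k K (f i))}

variable (K) in
/-- Rational sections of the `m`-th power of the anticanonical bundle: `K`-linear maps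
`ω_K^{⊗ m} → K`, written as `K`-multilinear maps in `m` variables. -/
abbrev RationalAnticanonicalSection (m : ℕ) : Type :=
  MultilinearMap K (fun _ : Fin m => RationalTopForm k K) K

variable {k}

/-- The rational section `s` of `ω^{⊗ (-m)}` is regular at the point with local ring `O`:
it maps `ω_x^{⊗ m}` to `O`. -/
def IsRegularAt {m : ℕ} (s : RationalAnticanonicalSection k K m) (O : Subring K) : Prop :=
  ∀ η : Fin m → RationalTopForm k K, (∀ i, η i ∈ regularTopForms k O) → s η ∈ O

/-- The section `s` of `ω^{⊗ (-m)}` does not vanish at the point with local ring `O`: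
it takes a unit of `O` as a value on `ω_x^{⊗ m}`. -/
def IsNonvanishingAt {m : ℕ} (s : RationalAnticanonicalSection k K m) (O : Subring K) : Prop :=
  ∃ η : Fin m → RationalTopForm k K, (∀ i, η i ∈ regularTopForms k O) ∧ ∃ u : Oˣ, s η = (u : O)

end Canonical

section Fano

variable {X : Scheme.{0}}

/-- The structure map `ℂ → K(X)` of the function field of an integral scheme over `ℂ`. -/
noncomputable def structureMapFunctionField (f : X ⟶ Spec (.of ℂ)) [IsIntegral X] :
    ℂ →+* X.functionField :=
  ((Scheme.ΓSpecIso (.of ℂ)).inv ≫ f.appTop ≫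
    X.presheaf.germ ⊤ (genericPoint X) trivial).hom

/-- The local ring of `X` at `x`, as a subring of the function field. -/
noncomputable def localSubring (X : Scheme.{0}) [IsIntegral X] (x : X) : Subring X.functionField :=
  (algebraMap (X.presheaf.stalk x) X.functionField).range

/-- The anticanonical bundle `ω⁻¹` of the (nonsingular) integral scheme `f : X ⟶ Spec ℂ` is ample:
`X` is quasi-compact, and every point `x` of `X` lies in an affine open set of the form
`X_s = {y | s y ≠ 0}`, with `s` a global section of `ω^{⊗ (-m)}` for some `m ≥ 1`. -/
def AnticanonicalAmple (f : X ⟶ Spec (.of ℂ)) [IsIntegral X] : Prop :=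
  letI : Algebra ℂ X.functionField := (structureMapFunctionField f).toAlgebra
  CompactSpace X ∧
  ∀ x : X, ∃ m : ℕ, 1 ≤ m ∧ ∃ s : RationalAnticanonicalSection ℂ X.functionField m,
    (∀ y : X, IsRegularAt s (localSubring X y)) ∧
    IsNonvanishingAt s (localSubring X x) ∧
    ∃ U : X.Opens, (∀ y : X, y ∈ U ↔ IsNonvanishingAt s (localSubring X y)) ∧ IsAffineOpen U

/-- A nonsingular complete variety `f : X ⟶ Spec ℂ` is Fano if its anticanonical bundle is
ample. -/
def IsFano (f : X ⟶ Spec (.of ℂ)) : Prop :=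
  ∃ _ : IsIntegral X, AnticanonicalAmple f

end Fano

/-! ## Fans -/

/-- The cone in `N_ℝ = ℝ ⊗ N` generated by a set of lattice vectors. -/
noncomputable def coneSpan {N : Type} [AddCommGroup N] (A : Set N) : PointedCone ℝ (ℝ ⊗[ℤ] N) :=
  PointedCone.hull ℝ ((fun v : N => (1 : ℝ) ⊗ₜ[ℤ] v) '' A)

/-- A nonsingular fan in the lattice `N`: a finite nonempty collection of cones in `N_ℝ`, each
generated by part of a `ℤ`-basis of `N`, closed under passing to faces, and such that the
intersection of two cones is a face of each.  A cone is recorded by its finite set of ray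
generators; its faces are the cones generated by the subsets. -/
structure NonsingularFan (N : Type) [AddCommGroup N] where
  /-- The sets of ray generators of the cones of the fan. -/
  cones : Set (Finset N)
  finite_cones : cones.Finite
  nonempty_cones : cones.Nonempty
  part_of_basis : ∀ A ∈ cones, ∃ (ι : Type) (b : Module.Basis ι ℤ N), (A : Set N) ⊆ Set.range b
  face_mem : ∀ A ∈ cones, ∀ B ⊆ A, B ∈ cones
  inter_eq : ∀ A ∈ cones, ∀ B ∈ cones,
    coneSpan (A : Set N) ⊓ coneSpan (B : Set N) = coneSpan ((A : Set N) ∩ (B : Set N))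

namespace NonsingularFan

variable {N : Type} [AddCommGroup N] (Δ : NonsingularFan N)

/-- The fan is complete: its cones cover `N_ℝ`. -/
def IsComplete : Prop :=
  ∀ x : ℝ ⊗[ℤ] N, ∃ A ∈ Δ.cones, x ∈ coneSpan (A : Set N)

/-- The ray generators of the fan; they correspond to the toric divisors. -/
def rays : Set N := {ρ | {ρ} ∈ Δ.cones}

open Classical in
/-- A primitive set, as a set of ray generators: it does not generate a cone of the fan, but it does
so after removal of any one of its elements. -/
def IsPrimitiveSet (P : Finset N) : Prop :=
  (∀ ρ ∈ P, ρ ∈ Δ.rays) ∧ P ∉ Δ.cones ∧ ∀ ρ ∈ P, P.erase ρ ∈ Δ.cones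

end NonsingularFan

/-! ## The toric variety of a nonsingular fan -/

/-- The monoid `σ^∨ ∩ M` of the cone `σ` with set of ray generators `A`, where `M = Hom(N, ℤ)`. -/
def dualMonoid {N : Type} [AddCommGroup N] (A : Finset N) : AddSubmonoid (Module.Dual ℤ N) where
  carrier := {m | ∀ ρ ∈ A, 0 ≤ m ρ}
  zero_mem' := fun _ _ => le_rfl
  add_mem' := fun ha hb ρ hρ => add_nonneg (ha ρ hρ) (hb ρ hρ)

theorem dualMonoid_anti {N : Type} [AddCommGroup N] {A B : Finset N} (h : A ⊆ B) :
    dualMonoid B ≤ dualMonoid A :=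
  fun _ hm ρ hρ => hm ρ (h hρ)

/-- The coordinate ring `ℂ[σ^∨ ∩ M]` of the affine toric variety of the cone `σ`. -/
abbrev ChartRing {N : Type} [AddCommGroup N] (A : Finset N) : Type :=
  AddMonoidAlgebra ℂ (dualMonoid A)

/-- The inclusion `ℂ[σ^∨ ∩ M] ⊆ ℂ[τ^∨ ∩ M]` for a face `τ` of `σ`. -/
noncomputable def chartMap {N : Type} [AddCommGroup N] {A B : Finset N} (h : A ⊆ B) :
    ChartRing B →+* ChartRing A :=
  AddMonoidAlgebra.mapDomainRingHom ℂ (AddSubmonoid.inclusion (dualMonoid_anti h))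

theorem chartMap_single {N : Type} [AddCommGroup N] {A B : Finset N} (h : A ⊆ B)
    (m : dualMonoid B) (c : ℂ) :
    chartMap h (AddMonoidAlgebra.single m c) =
      AddMonoidAlgebra.single (AddSubmonoid.inclusion (dualMonoid_anti h) m) c := by
  simp [chartMap]

theorem chartMap_refl {N : Type} [AddCommGroup N] (A : Finset N) (h : A ⊆ A) :
    chartMap h = RingHom.id (ChartRing A) := by
  exact AddMonoidAlgebra.mapDomainRingHom_id

theorem chartMap_comp {N : Type} [AddCommGroup N] {A B C : Finset N} (h : A ⊆ B) (h' : B ⊆ C) :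
    (chartMap h).comp (chartMap h') = chartMap (h.trans h') := by
  rw [chartMap, chartMap, ← AddMonoidAlgebra.mapDomainRingHom_comp]
  rfl

theorem chartMap_injective {N : Type} [AddCommGroup N] {A B : Finset N} (h : A ⊆ B) :
    Function.Injective (chartMap h) :=
  AddMonoidAlgebra.mapDomain_injective (AddSubmonoid.inclusion_injective _)

/-- If `u ∈ σ^∨ ∩ M` vanishes exactly on the face `τ` of `σ`, then `ℂ[τ^∨ ∩ M]` is the localization
of `ℂ[σ^∨ ∩ M]` at the character of `u`. -/
theorem chartMap_isLocalization {N : Type} [AddCommGroup N] {A B : Finset N} (h : A ⊆ B)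
    (u : dualMonoid B) (h0 : ∀ ρ ∈ A, u.1 ρ = 0) (h1 : ∀ ρ ∈ B, ρ ∉ A → 1 ≤ u.1 ρ) :
    letI := (chartMap h).toAlgebra
    IsLocalization.Away (AddMonoidAlgebra.single u (1 : ℂ)) (ChartRing A) := by
  let _ : Algebra (ChartRing B) (ChartRing A) := (chartMap h).toAlgebra
  have halg : algebraMap (ChartRing B) (ChartRing A) = chartMap h := rfl
  have hsingle : ∀ k : ℕ, chartMap h (AddMonoidAlgebra.single u (1 : ℂ) ^ k) =
      AddMonoidAlgebra.single (k • AddSubmonoid.inclusion (dualMonoid_anti h) u) 1 := by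
    intro k
    rw [AddMonoidAlgebra.single_pow, chartMap_single, one_pow, map_nsmul]
  have hunit : IsUnit (chartMap h (AddMonoidAlgebra.single u (1 : ℂ))) := by
    let v : dualMonoid A := ⟨-u.1, fun ρ hρ => by simp [h0 ρ hρ]⟩
    refine IsUnit.of_mul_eq_one (AddMonoidAlgebra.single v 1) ?_
    rw [chartMap_single, AddMonoidAlgebra.single_mul_single, one_mul, AddMonoidAlgebra.one_def]
    congr 1
    ext1
    simp [v]
  have hsurj : ∀ z : ChartRing A, ∃ k : ℕ, ∃ y : ChartRing B,
      z * chartMap h (AddMonoidAlgebra.single u (1 : ℂ) ^ k) = chartMap h y := by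
    intro z
    induction z using AddMonoidAlgebra.induction_linear with
    | zero => exact ⟨0, 0, by simp⟩
    | add z w hz hw =>
      obtain ⟨k, y, hy⟩ := hz
      obtain ⟨l, x, hx⟩ := hw
      refine ⟨k + l, y * AddMonoidAlgebra.single u (1 : ℂ) ^ l +
        x * AddMonoidAlgebra.single u (1 : ℂ) ^ k, ?_⟩
      rw [map_add, map_mul, map_mul, ← hy, ← hx, pow_add, map_mul]
      ring
    | single m c =>
      let k : ℕ := ∑ ρ ∈ B, (m.1 ρ).natAbs
      have hk : ∀ ρ ∈ B, 0 ≤ m.1 ρ + k * u.1 ρ := by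
        intro ρ hρ
        by_cases hA : ρ ∈ A
        · rw [h0 ρ hA]
          have := m.2 ρ hA
          omega
        · have h2 : (m.1 ρ).natAbs ≤ k :=
            Finset.single_le_sum (f := fun ρ => (m.1 ρ).natAbs) (fun _ _ => Nat.zero_le _) hρ
          have h3 := h1 ρ hρ hA
          have h4 : (k : ℤ) ≤ k * u.1 ρ := le_mul_of_one_le_right (by positivity) h3
          omega
      refine ⟨k, AddMonoidAlgebra.single
        (⟨m.1 + k • u.1, fun ρ hρ => by simpa using hk ρ hρ⟩ : dualMonoid B) c, ?_⟩
      rw [hsingle, chartMap_single, AddMonoidAlgebra.single_mul_single, mul_one]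
      congr 1
  refine IsLocalization.Away.mk _ hunit ?_ ?_
  · intro z
    obtain ⟨k, y, hy⟩ := hsurj z
    exact ⟨k, y, by rw [halg, ← map_pow]; exact hy⟩
  · intro a b hab
    exact ⟨0, by rw [chartMap_injective h hab]⟩

/-- The affine toric variety `Spec ℂ[σ^∨ ∩ M]` of the cone with ray generators `A`. -/
noncomputable def chart {N : Type} [AddCommGroup N] (A : Finset N) : Scheme.{0} :=
  Spec (.of (ChartRing A))

/-- The inclusion of the affine toric variety of a face. -/
noncomputable def chartInclusion {N : Type} [AddCommGroup N] {A B : Finset N} (h : A ⊆ B) :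
    chart A ⟶ chart B :=
  Spec.map (CommRingCat.ofHom (chartMap h))

theorem chartInclusion_isOpenImmersion {N : Type} [AddCommGroup N] {A B : Finset N} (h : A ⊆ B)
    (u : dualMonoid B) (h0 : ∀ ρ ∈ A, u.1 ρ = 0) (h1 : ∀ ρ ∈ B, ρ ∉ A → 1 ≤ u.1 ρ) :
    IsOpenImmersion (chartInclusion h) := by
  let _ : Algebra (ChartRing B) (ChartRing A) := (chartMap h).toAlgebra
  have := chartMap_isLocalization h u h0 h1
  exact IsOpenImmersion.of_isLocalization (AddMonoidAlgebra.single u (1 : ℂ))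

theorem range_chartInclusion {N : Type} [AddCommGroup N] {A B : Finset N} (h : A ⊆ B)
    (u : dualMonoid B) (h0 : ∀ ρ ∈ A, u.1 ρ = 0) (h1 : ∀ ρ ∈ B, ρ ∉ A → 1 ≤ u.1 ρ) :
    Set.range (chartInclusion h) =
      (PrimeSpectrum.basicOpen (AddMonoidAlgebra.single u (1 : ℂ)) :
        Set (PrimeSpectrum (ChartRing B))) := by
  let _ : Algebra (ChartRing B) (ChartRing A) := (chartMap h).toAlgebra
  have := chartMap_isLocalization h u h0 h1
  exact PrimeSpectrum.localization_away_comap_range (ChartRing A)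
    (AddMonoidAlgebra.single u (1 : ℂ))

namespace NonsingularFan

variable {N : Type} [AddCommGroup N] (Δ : NonsingularFan N)

theorem exists_supporting {A B : Finset N} (hB : B ∈ Δ.cones) :
    ∃ u : dualMonoid B, (∀ ρ ∈ A, ρ ∈ B → u.1 ρ = 0) ∧ ∀ ρ ∈ B, ρ ∉ A → 1 ≤ u.1 ρ := by
  classical
  obtain ⟨ι, b, hb⟩ := Δ.part_of_basis B hB
  let φ : Module.Dual ℤ N := b.constr ℤ (fun i => if b i ∈ A then 0 else 1)
  have hφ : ∀ ρ ∈ B, φ ρ = if ρ ∈ A then 0 else 1 := by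
    intro ρ hρ
    obtain ⟨i, rfl⟩ := hb hρ
    simp [φ, Module.Basis.constr_basis]
  refine ⟨⟨φ, fun ρ hρ => ?_⟩, fun ρ hA hρ => ?_, fun ρ hρ hA => ?_⟩
  · rw [hφ ρ hρ]; split_ifs <;> simp
  · simp [hφ ρ hρ, hA]
  · simp [hφ ρ hρ, hA]

/-- The diagram of the affine toric varieties of the cones of the fan, indexed by the poset of
cones. -/
noncomputable def diagram : Δ.cones ⥤ Scheme.{0} where
  obj A := chart A.1
  map f := chartInclusion (leOfHom f)
  map_id A := by
    rw [chartInclusion, chartMap_refl]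
    exact Spec.map_id _
  map_comp f g := by
    rw [chartInclusion, ← chartMap_comp (leOfHom f) (leOfHom g), CommRingCat.ofHom_comp,
      Spec.map_comp]
    rfl

instance {A B : Δ.cones} (f : A ⟶ B) : IsOpenImmersion (Δ.diagram.map f) := by
  obtain ⟨u, h0, h1⟩ := Δ.exists_supporting (A := A.1) B.2
  exact chartInclusion_isOpenImmersion (leOfHom f) u (fun ρ hρ => h0 ρ hρ (leOfHom f hρ)) h1

instance : (Δ.diagram ⋙ Scheme.forget).IsLocallyDirected := by
  classical
  constructor
  intro A B C f g x y hxy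
  change Δ.diagram.map f x = Δ.diagram.map g y at hxy
  let D : Δ.cones := ⟨A.1 ∩ B.1, Δ.face_mem _ A.2 _ Finset.inter_subset_left⟩
  let p : D ⟶ A := homOfLE Finset.inter_subset_left
  let q : D ⟶ B := homOfLE Finset.inter_subset_right
  obtain ⟨u, hu0, hu1⟩ := Δ.exists_supporting (A := A.1) C.2
  obtain ⟨v, hv0, hv1⟩ := Δ.exists_supporting (A := B.1) C.2
  have hA : (A : Finset N) ⊆ C := leOfHom f
  have hB : (B : Finset N) ⊆ C := leOfHom g
  have hx : Δ.diagram.map f x ∈ (PrimeSpectrum.basicOpen (AddMonoidAlgebra.single u (1 : ℂ)) :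
      Set (PrimeSpectrum (ChartRing C.1))) := by
    rw [← range_chartInclusion hA u (fun ρ hρ => hu0 ρ hρ (hA hρ)) hu1]
    exact ⟨x, rfl⟩
  have hy : Δ.diagram.map f x ∈ (PrimeSpectrum.basicOpen (AddMonoidAlgebra.single v (1 : ℂ)) :
      Set (PrimeSpectrum (ChartRing C.1))) := by
    rw [hxy, ← range_chartInclusion hB v (fun ρ hρ => hv0 ρ hρ (hB hρ)) hv1]
    exact ⟨y, rfl⟩
  have hz : Δ.diagram.map f x ∈
      (PrimeSpectrum.basicOpen (AddMonoidAlgebra.single (u + v) (1 : ℂ)) :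
      Set (PrimeSpectrum (ChartRing C.1))) := by
    have : AddMonoidAlgebra.single (u + v) (1 : ℂ) =
        AddMonoidAlgebra.single u (1 : ℂ) * AddMonoidAlgebra.single v (1 : ℂ) := by
      rw [AddMonoidAlgebra.single_mul_single, one_mul]
    rw [this, PrimeSpectrum.basicOpen_mul]
    exact ⟨hx, hy⟩
  have hD : (D : Finset N) ⊆ C := leOfHom (p ≫ f)
  rw [← range_chartInclusion hD (u + v)] at hz
  · obtain ⟨z, hz⟩ := hz
    change Δ.diagram.map (p ≫ f) z = _ at hz
    refine ⟨D, p, q, z, ?_, ?_⟩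
    · apply (Δ.diagram.map f).isOpenEmbedding.injective
      rw [← hz, Functor.map_comp]
      rfl
    · apply (Δ.diagram.map g).isOpenEmbedding.injective
      rw [← hxy, ← hz, Subsingleton.elim (p ≫ f) (q ≫ g), Functor.map_comp]
      rfl
  · intro ρ hρ
    have h1 := hu0 ρ (Finset.mem_of_mem_inter_left hρ) (hD hρ)
    have h2 := hv0 ρ (Finset.mem_of_mem_inter_right hρ) (hD hρ)
    simp [h1, h2]
  · intro ρ hρ hn
    have h1 := u.2 ρ hρ
    have h2 := v.2 ρ hρ
    change 1 ≤ u.1 ρ + v.1 ρ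
    by_cases h : ρ ∈ A.1
    · have := hv1 ρ hρ (fun hb => hn (Finset.mem_inter.2 ⟨h, hb⟩))
      omega
    · have := hu1 ρ hρ h
      omega

/-- The toric variety `X(Δ)` of the fan: the affine toric varieties of the cones, glued along those
of the common faces. -/
noncomputable def toricVariety : Scheme.{0} := colimit Δ.diagram

/-- The structure morphism `X(Δ) ⟶ Spec ℂ`. -/
noncomputable def structureMorphism : Δ.toricVariety ⟶ Spec (.of ℂ) :=
  colimit.desc Δ.diagram
    { pt := Spec (.of ℂ)
      ι :=
        { app := fun A => Spec.map (CommRingCat.ofHom (algebraMap ℂ (ChartRing A.1)))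
          naturality := fun A B f => by
            change Spec.map (CommRingCat.ofHom (chartMap _)) ≫ _ = _ ≫ 𝟙 _
            rw [Category.comp_id, ← Spec.map_comp, ← CommRingCat.ofHom_comp]
            congr 2
            exact AddMonoidAlgebra.mapDomainRingHom_comp_algebraMap _ } }

end NonsingularFan

/-! ## The star of a cone -/

theorem coneSpan_mono {N : Type} [AddCommGroup N] {A B : Set N} (h : A ⊆ B) :
    coneSpan A ≤ coneSpan B :=
  Submodule.span_mono (Set.image_mono h)

/-- The image of a cone under the projection modulo the sublattice generated by `σ`. -/
theorem map_coneSpan_quotient {N : Type} [AddCommGroup N] (σ A : Set N) :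
    (coneSpan A).map ((Submodule.span ℤ σ).mkQ.baseChange ℝ) =
      coneSpan ((Submodule.span ℤ σ).mkQ '' (A \ σ)) := by
  rw [coneSpan, coneSpan, PointedCone.map, Submodule.map_span]
  apply le_antisymm
  · rw [Submodule.span_le]
    rintro _ ⟨_, ⟨v, hv, rfl⟩, rfl⟩
    by_cases hσ : v ∈ σ
    · have : (Submodule.span ℤ σ).mkQ v = 0 := by
        simpa using Submodule.subset_span hσ
      simp only [LinearMap.coe_restrictScalars, LinearMap.baseChange_tmul, this, tmul_zero]
      exact Submodule.zero_mem _
    · exact Submodule.subset_span ⟨_, ⟨v, ⟨hv, hσ⟩, rfl⟩, by simp⟩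
  · refine Submodule.span_mono ?_
    rintro _ ⟨_, ⟨v, hv, rfl⟩, rfl⟩
    exact ⟨_, ⟨v, hv.1, rfl⟩, by simp⟩

/-- Every vector in the kernel of the projection `N_ℝ → (N / ⟨σ⟩)_ℝ` is a difference of vectors of
the cone generated by `σ`. -/
theorem exists_sub_of_baseChange_mkQ_eq_zero {N : Type} [AddCommGroup N] (σ : Set N)
    (x : ℝ ⊗[ℤ] N) (hx : (Submodule.span ℤ σ).mkQ.baseChange ℝ x = 0) :
    ∃ y ∈ coneSpan σ, ∃ z ∈ coneSpan σ, x = y - z := by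
  have hex := lTensor_exact ℝ (LinearMap.exact_subtype_mkQ (Submodule.span ℤ σ))
    (Submodule.mkQ_surjective _)
  obtain ⟨w, rfl⟩ := (hex x).1 hx
  clear hx hex
  have key : ∀ (n : N), n ∈ Submodule.span ℤ σ → ∀ r : ℝ, 0 ≤ r →
      ∃ y ∈ coneSpan σ, ∃ z ∈ coneSpan σ, r ⊗ₜ[ℤ] n = y - z := by
    intro n hn
    induction hn using Submodule.span_induction with
    | mem v hv =>
      intro r hr
      refine ⟨r ⊗ₜ v, ?_, 0, Submodule.zero_mem _, by simp⟩
      have : r ⊗ₜ[ℤ] v = (⟨r, hr⟩ : {c : ℝ // 0 ≤ c}) • ((1 : ℝ) ⊗ₜ[ℤ] v) := by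
        change _ = r • ((1 : ℝ) ⊗ₜ[ℤ] v)
        rw [smul_tmul', smul_eq_mul, mul_one]
      rw [this]
      exact Submodule.smul_mem _ _ (Submodule.subset_span ⟨v, hv, rfl⟩)
    | zero => exact fun r _ => ⟨0, Submodule.zero_mem _, 0, Submodule.zero_mem _, by simp⟩
    | add a b _ _ ha hb =>
      intro r hr
      obtain ⟨y, hy, z, hz, h⟩ := ha r hr
      obtain ⟨y', hy', z', hz', h'⟩ := hb r hr
      exact ⟨y + y', add_mem hy hy', z + z', add_mem hz hz', by rw [tmul_add, h, h']; abel⟩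
    | smul c a _ ha =>
      intro r hr
      rcases le_total 0 c with hc | hc
      · obtain ⟨y, hy, z, hz, h⟩ := ha (c * r) (by positivity)
        refine ⟨y, hy, z, hz, ?_⟩
        rw [← h, ← smul_tmul, zsmul_eq_mul]
      · obtain ⟨y, hy, z, hz, h⟩ := ha (-c * r)
          (mul_nonneg (by exact_mod_cast neg_nonneg.2 hc) hr)
        refine ⟨z, hz, y, hy, ?_⟩
        rw [← neg_sub, ← h, ← smul_tmul, zsmul_eq_mul, neg_mul, neg_tmul, neg_neg]
  induction w using TensorProduct.induction_on with
  | zero => exact ⟨0, Submodule.zero_mem _, 0, Submodule.zero_mem _, by simp⟩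
  | tmul r n =>
    rcases le_total 0 r with hr | hr
    · simpa using key n n.2 r hr
    · obtain ⟨y, hy, z, hz, h⟩ := key n n.2 (-r) (by linarith)
      refine ⟨z, hz, y, hy, ?_⟩
      rw [← neg_sub, ← h, neg_tmul, neg_neg]
      simp
  | add a b ha hb =>
    obtain ⟨y, hy, z, hz, h⟩ := ha
    obtain ⟨y', hy', z', hz', h'⟩ := hb
    exact ⟨y + y', add_mem hy hy', z + z', add_mem hz hz', by rw [map_add, h, h']; abel⟩

/-- The images in `N / ⟨σ⟩` of the remaining vectors of a basis containing `σ` form a basis. -/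
theorem exists_basis_quotient {N : Type} [AddCommGroup N] (σ : Set N) {ι : Type}
    (b : Module.Basis ι ℤ N) (hσ : σ ⊆ Set.range b) :
    ∃ b' : Module.Basis {i // b i ∉ σ} ℤ (N ⧸ Submodule.span ℤ σ),
      ∀ i, b' i = (Submodule.span ℤ σ).mkQ (b i) := by
  have himg : b '' {i | b i ∈ σ} = σ := by
    ext v
    constructor
    · rintro ⟨i, hi, rfl⟩
      exact hi
    · intro hv
      obtain ⟨i, rfl⟩ := hσ hv
      exact ⟨i, hv, rfl⟩
  have hdis : Disjoint {i | b i ∈ σ} {i | b i ∉ σ} :=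
    Set.disjoint_left.2 fun i hi hi' => hi' hi
  have hli : LinearIndepOn ℤ ((Submodule.span ℤ σ).mkQ ∘ b) {i | b i ∉ σ} := by
    have := ((linearIndepOn_union_iff_quotient (R := ℤ) (f := b) hdis).1
      (b.linearIndependent.linearIndepOn _)).2
    rwa [himg] at this
  refine ⟨Module.Basis.mk (v := fun i : {i // b i ∉ σ} => (Submodule.span ℤ σ).mkQ (b i)) hli ?_,
    fun i => by simp⟩
  intro x _
  obtain ⟨n, rfl⟩ := Submodule.mkQ_surjective _ x
  have hn : n ∈ Submodule.span ℤ (Set.range b) := by rw [b.span_eq]; trivial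
  induction hn using Submodule.span_induction with
  | mem v hv =>
    obtain ⟨i, rfl⟩ := hv
    by_cases hi : b i ∈ σ
    · have : (Submodule.span ℤ σ).mkQ (b i) = 0 := by
        simpa using Submodule.subset_span hi
      rw [this]
      exact Submodule.zero_mem _
    · exact Submodule.subset_span ⟨⟨i, hi⟩, rfl⟩
  | zero => simp
  | add a c _ _ ha hc => rw [map_add]; exact add_mem (ha trivial) (hc trivial)
  | smul r a _ ha => rw [map_smul]; exact Submodule.smul_mem _ _ (ha trivial)

namespace NonsingularFan

variable {N : Type} [AddCommGroup N] (Δ : NonsingularFan N)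

/-- The star `Δ(σ)` of a cone `σ` of the fan: the fan in `N / ⟨σ⟩` whose cones are the images of the
cones of `Δ` that contain `σ`. -/
def starFan (σ : Finset N) (hσ : σ ∈ Δ.cones) :
    NonsingularFan (N ⧸ Submodule.span ℤ (σ : Set N)) where
  cones := {B | ∃ A ∈ Δ.cones, σ ⊆ A ∧
    (B : Set (N ⧸ Submodule.span ℤ (σ : Set N))) =
      (Submodule.span ℤ (σ : Set N)).mkQ '' ((A : Set N) \ (σ : Set N))}
  finite_cones := by
    refine Set.Finite.of_finite_image (f := (SetLike.coe : Finset _ → Set _)) ?_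
      Finset.coe_injective.injOn
    refine (Δ.finite_cones.image fun A : Finset N =>
      (Submodule.span ℤ (σ : Set N)).mkQ '' ((A : Set N) \ (σ : Set N))).subset ?_
    rintro _ ⟨B, ⟨A, hA, _, h⟩, rfl⟩
    exact ⟨A, hA, h.symm⟩
  nonempty_cones := ⟨∅, σ, hσ, subset_rfl, by simp⟩
  part_of_basis := by
    rintro B ⟨A, hA, hσA, hB⟩
    obtain ⟨ι, b, hb⟩ := Δ.part_of_basis A hA
    obtain ⟨b', hb'⟩ := exists_basis_quotient (σ : Set N) b
      ((Finset.coe_subset.2 hσA).trans hb)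
    refine ⟨_, b', ?_⟩
    rw [hB]
    rintro _ ⟨v, ⟨hv, hvσ⟩, rfl⟩
    obtain ⟨i, rfl⟩ := hb hv
    exact ⟨⟨i, hvσ⟩, hb' _⟩
  face_mem := by
    classical
    rintro B ⟨A, hA, hσA, hB⟩ B' hB'
    refine ⟨A.filter fun v => v ∈ σ ∨ (Submodule.span ℤ (σ : Set N)).mkQ v ∈ B',
      Δ.face_mem A hA _ (Finset.filter_subset _ _),
      fun v hv => Finset.mem_filter.2 ⟨hσA hv, Or.inl hv⟩, ?_⟩
    ext x
    constructor
    · intro hx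
      have hx' : x ∈ (B : Set _) := hB' hx
      rw [hB] at hx'
      obtain ⟨v, hv, rfl⟩ := hx'
      exact ⟨v, ⟨Finset.mem_coe.2 (Finset.mem_filter.2 ⟨hv.1, Or.inr hx⟩), hv.2⟩, rfl⟩
    · rintro ⟨v, ⟨hv, hvσ⟩, rfl⟩
      exact (Finset.mem_filter.1 (Finset.mem_coe.1 hv)).2.resolve_left hvσ
  inter_eq := by
    rintro B ⟨A, hA, hσA, hB⟩ B' ⟨A', hA', hσA', hB'⟩
    apply le_antisymm
    · rw [hB, hB', ← map_coneSpan_quotient, ← map_coneSpan_quotient]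
      rintro _ ⟨⟨x, hx, rfl⟩, ⟨x', hx', hxx'⟩⟩
      obtain ⟨y, hy, z, hz, h⟩ := exists_sub_of_baseChange_mkQ_eq_zero (σ : Set N) (x - x')
        (by rw [map_sub, sub_eq_zero]; exact hxx'.symm)
      have hmem : x + z ∈ coneSpan ((A : Set N) ∩ (A' : Set N)) := by
        rw [← Δ.inter_eq A hA A' hA']
        refine ⟨add_mem hx (coneSpan_mono (Finset.coe_subset.2 hσA) hz), ?_⟩
        have : x + z = x' + y := by rw [sub_eq_sub_iff_add_eq_add] at h; rw [h, add_comm]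
        rw [this]
        exact add_mem hx' (coneSpan_mono (Finset.coe_subset.2 hσA') hy)
      have hz0 : (Submodule.span ℤ (σ : Set N)).mkQ.baseChange ℝ z = 0 := by
        have h1 : (Submodule.span ℤ (σ : Set N)).mkQ.baseChange ℝ z ∈
            (coneSpan (σ : Set N)).map ((Submodule.span ℤ (σ : Set N)).mkQ.baseChange ℝ) :=
          ⟨z, hz, rfl⟩
        rw [map_coneSpan_quotient] at h1
        simpa [coneSpan] using h1
      have h2 : (Submodule.span ℤ (σ : Set N)).mkQ.baseChange ℝ (x + z) ∈
          (coneSpan ((A : Set N) ∩ (A' : Set N))).map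
            ((Submodule.span ℤ (σ : Set N)).mkQ.baseChange ℝ) := ⟨_, hmem, rfl⟩
      rw [map_add, hz0, add_zero, map_coneSpan_quotient] at h2
      refine coneSpan_mono ?_ h2
      rintro _ ⟨v, ⟨⟨hv, hv'⟩, hvσ⟩, rfl⟩
      exact ⟨⟨v, ⟨hv, hvσ⟩, rfl⟩, ⟨v, ⟨hv', hvσ⟩, rfl⟩⟩
    · exact le_inf (coneSpan_mono Set.inter_subset_left) (coneSpan_mono Set.inter_subset_right)

end NonsingularFan

end ToricFano

/-!
# Fano toric varieties whose toric subvarieties are all Fano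

The argument has a geometric part, which translates the ampleness of the anticanonical bundle into
a condition on the fan, and a combinatorial part.

**Ampleness.** For a maximal cone `μ` let `u` be the functional equal to `1` on its generators. By
`IsStarComplete.isFano_iff_isNumericallyFano`, the toric variety is Fano if and only if `u ρ ≤ 0`
for every ray generator `ρ` outside `μ`. The function field is the fraction field of the ring
`ℂ[M]` of characters (`exists_isTorusField`), and on the chart of `μ` the canonical sheaf is
generated by `χ^u` times the logarithmic form `dx₁/x₁ ∧ ⋯ ∧ dxₙ/xₙ`
(`IsChartLocalRing.exists_span`); so a section of a power of the anticanonical bundle is a rational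
function `g`, with local equation `χ^(m u) g` on that chart.

* If the inequalities hold, then `g = χ^(-u)` is a regular section whose nonvanishing locus is
  exactly the chart of `μ`, and these charts cover the variety.
* Conversely, let `s` be a section that does not vanish at the fixed point of `μ` and has an affine
  nonvanishing locus `U`. Its local equation on the chart of `μ` has a constant term, so on a chart
  containing the generic point `η` of the divisor of `ρ` the local equation contains the monomial
  `χ^(m (v - u))`, where `v ρ = 1`. This monomial is regular, so `u ρ ≤ 1`. If `u ρ = 1`, then the
  local equation does not vanish at `η`, so `η ∈ U`; the same reasoning applied to a function on
  `U` times a power of `s` shows that a regular function on `U` that does not vanish at the fixed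
  point does not vanish at `η`. As `U` is affine, the local ring at the fixed point is contained in
  the local ring at `η`. But a character that is regular on the chart of `μ` and negative on `ρ`
  lies in the first ring and not in the second.

The star of a cone `σ` inherits completeness (in the integral form `IsStarComplete`), and its
numerical condition can be read off in the original fan, as `IsFanoAlong σ`
(`isNumericallyFano_starFan_iff`).

**Combinatorics.** The three conditions are linked by `RaysReduceModulo σ`: modulo the sublattice of
any cone `σ`, each ray generator is zero or a ray generator of the star of `σ`.

* The condition on primitive sets implies it: a ray generator `ρ` that is not adjacent to `σ` is
  replaced by the sum of a primitive set contained in `{ρ} ∪ σ`.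
* The Fano condition on all stars implies it, by adding the generators of `σ` one at a time: in the
  star of a smaller cone, the sum of two rays that span no cone is zero or a ray generator, because
  the relation has positive anticanonical degree.
* It implies the bounds on the coordinates, by reduction modulo the faces of `μ` of codimension one
  (a fan in a line) and two (a complete fan in a plane).
* The bounds on the coordinates give back the numerical Fano condition for all stars and the
  condition on primitive sets, by inspection of signs and of coordinates equal to `1`.
-/

namespace ToricFano

open TensorProduct

/-! ### Integral linear algebra of the cones of a fan -/

section Cones

variable {N : Type} [AddCommGroup N]

/-- A lattice vector in the cone generated by part of a basis has nonnegative coordinates, which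
vanish off the generators of the cone. -/
theorem repr_nonneg_of_mem_coneSpan {ι : Type} (b : Module.Basis ι ℤ N) {A : Set N}
    (hA : A ⊆ Set.range b) {v : N} (hv : (1 : ℝ) ⊗ₜ[ℤ] v ∈ coneSpan A) (i : ι) :
    0 ≤ b.repr v i ∧ (b i ∉ A → b.repr v i = 0) := by
  have key : ∀ x ∈ coneSpan A, 0 ≤ (b.baseChange ℝ).repr x i ∧
      (b i ∉ A → (b.baseChange ℝ).repr x i = 0) := by
    intro x hx
    induction hx using Submodule.span_induction with
    | mem x hx =>
      obtain ⟨w, hw, rfl⟩ := hx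
      obtain ⟨j, rfl⟩ := hA hw
      rw [Module.Basis.baseChange_repr_tmul, b.repr_self]
      by_cases hij : j = i
      · subst hij
        simp [hw]
      · simp [Finsupp.single_eq_of_ne' hij]
    | zero => simp
    | add x y _ _ hx hy =>
      simp only [map_add, Finsupp.add_apply]
      exact ⟨add_nonneg hx.1 hy.1, fun h => by rw [hx.2 h, hy.2 h, add_zero]⟩
    | smul c x _ hx =>
      have : (c • x : ℝ ⊗[ℤ] N) = (c : ℝ) • x := rfl
      rw [this, map_smul, Finsupp.smul_apply, smul_eq_mul]
      exact ⟨mul_nonneg c.2 hx.1, fun h => by rw [hx.2 h, mul_zero]⟩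
  have := key _ hv
  rw [Module.Basis.baseChange_repr_tmul, zsmul_eq_mul, mul_one] at this
  exact_mod_cast this

theorem tmul_sum_mem_coneSpan {A : Finset N} {c : N → ℤ} (hc : ∀ v ∈ A, 0 ≤ c v) :
    (1 : ℝ) ⊗ₜ[ℤ] (∑ v ∈ A, c v • v) ∈ coneSpan (A : Set N) := by
  rw [tmul_sum]
  refine Submodule.sum_mem _ fun v hv => ?_
  have h0 : (0 : ℝ) ≤ c v := by exact_mod_cast hc v hv
  have : (1 : ℝ) ⊗ₜ[ℤ] (c v • v) = (⟨(c v : ℝ), h0⟩ : {r : ℝ // 0 ≤ r}) • ((1 : ℝ) ⊗ₜ[ℤ] v) := by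
    change _ = (c v : ℝ) • ((1 : ℝ) ⊗ₜ[ℤ] v)
    rw [tmul_smul, Int.cast_smul_eq_zsmul]
  rw [this]
  exact Submodule.smul_mem _ _ (Submodule.subset_span ⟨v, hv, rfl⟩)

open Classical in
theorem repr_sum_smul {ι : Type} (b : Module.Basis ι ℤ N) {A : Finset N}
    (hA : (A : Set N) ⊆ Set.range b) (c : N → ℤ) (i : ι) :
    b.repr (∑ v ∈ A, c v • v) i = if b i ∈ A then c (b i) else 0 := by
  rw [map_sum, Finsupp.finsetSum_apply]
  have : ∀ v ∈ A, (b.repr (c v • v)) i = if b i = v then c v else 0 := by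
    intro v hv
    obtain ⟨j, rfl⟩ := hA hv
    rw [map_smul, b.repr_self, Finsupp.smul_apply, smul_eq_mul]
    by_cases h : j = i
    · subst h; simp
    · rw [Finsupp.single_eq_of_ne' h, mul_zero, if_neg fun h' => h (b.injective h').symm]
  rw [Finset.sum_congr rfl this, Finset.sum_ite_eq]

end Cones

namespace NonsingularFan

variable {N : Type} [AddCommGroup N] {Δ : NonsingularFan N}

/-- Functionals on the lattice can be prescribed on the ray generators of a cone. -/
theorem exists_dual_eq {A : Finset N} (hA : A ∈ Δ.cones) (f : N → ℤ) :
    ∃ u : Module.Dual ℤ N, ∀ v ∈ A, u v = f v := by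
  obtain ⟨ι, b, hb⟩ := Δ.part_of_basis A hA
  refine ⟨b.constr ℤ (fun i => f (b i)), fun v hv => ?_⟩
  obtain ⟨i, rfl⟩ := hb hv
  rw [Module.Basis.constr_basis]

/-- A lattice vector has only one expression as a nonnegative combination of the ray generators
of a cone of the fan. -/
theorem coeff_eq_of_sum_eq {A B : Finset N} (hA : A ∈ Δ.cones) (hB : B ∈ Δ.cones) {a c : N → ℤ}
    (ha : ∀ v ∈ A, 0 ≤ a v) (hc : ∀ v ∈ B, 0 ≤ c v)
    (h : ∑ v ∈ A, a v • v = ∑ v ∈ B, c v • v) {v : N} (hv : v ∈ A) :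
    (v ∉ B → a v = 0) ∧ (v ∈ B → a v = c v) := by
  classical
  have key : ∀ (A B : Finset N), A ∈ Δ.cones → B ∈ Δ.cones → ∀ a c : N → ℤ, (∀ v ∈ A, 0 ≤ a v) →
      (∀ v ∈ B, 0 ≤ c v) → ∑ v ∈ A, a v • v = ∑ v ∈ B, c v • v → ∀ v ∈ A, v ∉ B → a v = 0 := by
    intro A B hA hB a c ha hc h v hv hvB
    obtain ⟨ι, b, hb⟩ := Δ.part_of_basis A hA
    have hx : (1 : ℝ) ⊗ₜ[ℤ] (∑ v ∈ A, a v • v) ∈ coneSpan ((A : Set N) ∩ (B : Set N)) := by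
      rw [← Δ.inter_eq A hA B hB]
      exact ⟨tmul_sum_mem_coneSpan ha, h ▸ tmul_sum_mem_coneSpan hc⟩
    obtain ⟨i, rfl⟩ := hb hv
    have := (repr_nonneg_of_mem_coneSpan b (Set.inter_subset_left.trans hb) hx i).2
      (fun h' => hvB h'.2)
    rwa [repr_sum_smul b hb, if_pos (Finset.mem_coe.1 hv)] at this
  refine ⟨key A B hA hB a c ha hc h v hv, fun hvB => ?_⟩
  obtain ⟨u, hu⟩ := exists_dual_eq hA fun w => if w = v then 1 else 0
  have h1 : ∑ w ∈ A, a w • w = ∑ w ∈ A ∩ B, a w • w := by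
    refine (Finset.sum_subset Finset.inter_subset_left fun w hw hw' => ?_).symm
    rw [key A B hA hB a c ha hc h w hw fun hwB => hw' (Finset.mem_inter.2 ⟨hw, hwB⟩), zero_smul]
  have h2 : ∑ w ∈ B, c w • w = ∑ w ∈ A ∩ B, c w • w := by
    refine (Finset.sum_subset Finset.inter_subset_right fun w hw hw' => ?_).symm
    rw [key B A hB hA c a hc ha h.symm w hw fun hwA => hw' (Finset.mem_inter.2 ⟨hwA, hw⟩),
      zero_smul]
  have h3 : ∀ d : N → ℤ, u (∑ w ∈ A ∩ B, d w • w) = d v := by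
    intro d
    rw [map_sum, Finset.sum_eq_single v]
    · rw [map_smul, hu v hv, if_pos rfl, smul_eq_mul, mul_one]
    · intro w hw hwv
      rw [map_smul, hu w (Finset.mem_inter.1 hw).1, if_neg hwv, smul_zero]
    · exact fun hn => absurd (Finset.mem_inter.2 ⟨hv, hvB⟩) hn
  rw [← h3 a, ← h3 c, ← h1, ← h2, h]

/-- If two vectors of two cones containing `σ` agree modulo `⟨σ⟩` and lie outside `σ`, they
are equal. -/
theorem eq_of_sub_mem_span {σ A B : Finset N} (hA : A ∈ Δ.cones) (hB : B ∈ Δ.cones) (hσA : σ ⊆ A)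
    (hσB : σ ⊆ B) {v w : N} (hv : v ∈ A) (hvσ : v ∉ σ) (hw : w ∈ B)
    (h : v - w ∈ Submodule.span ℤ (σ : Set N)) : v = w := by
  classical
  obtain ⟨d, hd⟩ := (Submodule.mem_span_finset'.1 h)
  let d' : N → ℤ := fun x => if hx : x ∈ σ then d ⟨x, hx⟩ else 0
  have hd' : ∑ x ∈ σ, d' x • x = v - w := by
    rw [← hd, ← Finset.sum_coe_sort]
    exact Finset.sum_congr rfl fun x _ => by simp [d']
  have hrel : ∑ x ∈ A, ((if x ∈ σ then (d' x)⁻ else 0) + if x = v then 1 else 0) • x =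
      ∑ x ∈ B, ((if x ∈ σ then (d' x)⁺ else 0) + if x = w then 1 else 0) • x := by
    simp only [add_smul, ite_smul, zero_smul, one_smul, Finset.sum_add_distrib,
      Finset.sum_ite_eq', hv, hw, if_true, Finset.sum_ite_mem, Finset.inter_eq_right.2 hσA,
      Finset.inter_eq_right.2 hσB]
    have : ∑ x ∈ σ, (d' x)⁺ • x - ∑ x ∈ σ, (d' x)⁻ • x = v - w := by
      rw [← Finset.sum_sub_distrib, ← hd']
      exact Finset.sum_congr rfl fun x _ => by rw [← sub_smul, posPart_sub_negPart]
    rw [sub_eq_sub_iff_add_eq_add] at this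
    rw [add_comm, ← this]
  have := coeff_eq_of_sum_eq hA hB (fun x _ => ?_) (fun x _ => ?_) hrel hv
  · by_contra hvw
    by_cases hvB : v ∈ B
    · simpa [hvσ, hvw] using this.2 hvB
    · simpa [hvσ] using this.1 hvB
  · split_ifs <;> positivity
  · split_ifs <;> positivity

end NonsingularFan
end ToricFano

namespace ToricFano

open TensorProduct

/-! ### Maximal cones of complete fans -/

namespace NonsingularFan

variable {N : Type} [AddCommGroup N] {Δ : NonsingularFan N}

variable (Δ) in
/-- Integral form of the completeness of all the stars of the fan: modulo `⟨σ⟩`, every lattice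
vector is a nonnegative combination of the generators of a maximal cone containing `σ`. -/
def IsStarComplete : Prop :=
  ∀ σ ∈ Δ.cones, ∀ v : N, ∃ B, Maximal (fun A => A ∈ Δ.cones) B ∧ σ ⊆ B ∧
    ∃ c : N → ℤ, v = ∑ w ∈ B, c w • w ∧ ∀ w ∈ B, w ∉ σ → 0 ≤ c w

theorem exists_maximal_of_mem {σ : Finset N} (hσ : σ ∈ Δ.cones) :
    ∃ μ, Maximal (fun A => A ∈ Δ.cones) μ ∧ σ ⊆ μ := by
  obtain ⟨μ, h, hμ⟩ := Δ.finite_cones.exists_le_maximal hσ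
  exact ⟨μ, hμ, h⟩

/-- The vectors `t ∑ σ + v`, for `t = 0, 1, 2, …`, lie in finitely many cones, so one cone contains
infinitely many of them; it contains `σ` and, modulo `⟨σ⟩`, the vector `v`. -/
theorem IsComplete.isStarComplete (hΔ : Δ.IsComplete) : Δ.IsStarComplete := by
  classical
  intro σ hσ v
  let x : ℕ → N := fun t => t • ∑ w ∈ σ, w + v
  choose C hC hCx using fun t => hΔ (1 ⊗ₜ x t)
  have : Finite Δ.cones := Δ.finite_cones
  obtain ⟨⟨B, hB⟩, hinf⟩ := Finite.exists_infinite_fiber fun t => (⟨C t, hC t⟩ : Δ.cones)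
  have hS : {t : ℕ | (1 : ℝ) ⊗ₜ[ℤ] x t ∈ coneSpan (B : Set N)}.Infinite := by
    refine (Set.infinite_coe_iff.1 hinf).mono fun t ht => ?_
    have h : C t = B := congrArg Subtype.val ht
    exact h ▸ hCx t
  obtain ⟨ι, b, hb⟩ := Δ.part_of_basis B hB
  have hrepr : ∀ t i, b.repr (x t) i = t * b.repr (∑ w ∈ σ, w) i + b.repr v i := by
    intro t i
    simp [x, map_add, map_nsmul]
  have hcoord : ∀ i, 0 ≤ b.repr (∑ w ∈ σ, w) i ∧
      (b i ∉ B → b.repr (∑ w ∈ σ, w) i = 0 ∧ b.repr v i = 0) := by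
    intro i
    obtain ⟨t, ht, -⟩ := hS.exists_gt 0
    obtain ⟨s, hs, hst⟩ := hS.exists_gt (max t (b.repr v i).natAbs)
    have h1 := repr_nonneg_of_mem_coneSpan b hb ht i
    have h2 := repr_nonneg_of_mem_coneSpan b hb hs i
    rw [hrepr] at h1 h2
    have hst1 : t < s := lt_of_le_of_lt (le_max_left _ _) hst
    have hst2 : (b.repr v i).natAbs < s := lt_of_le_of_lt (le_max_right _ _) hst
    refine ⟨?_, fun hi => ?_⟩
    · by_contra hneg
      push Not at hneg
      have : (s : ℤ) * b.repr (∑ w ∈ σ, w) i ≤ s * (-1) :=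
        mul_le_mul_of_nonneg_left (by omega) (by positivity)
      omega
    · have e1 := h1.2 hi
      have e2 := h2.2 hi
      have : ((s : ℤ) - t) * b.repr (∑ w ∈ σ, w) i = 0 := by linarith
      have h0 : b.repr (∑ w ∈ σ, w) i = 0 := by
        rcases mul_eq_zero.1 this with h | h
        · omega
        · exact h
      exact ⟨h0, by rwa [h0, mul_zero, zero_add] at e1⟩
  have hexp : ∀ y : N, (∀ i, b i ∉ B → b.repr y i = 0) →
      ∃ c : N → ℤ, (∀ i, c (b i) = b.repr y i) ∧ y = ∑ w ∈ B, c w • w := by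
    intro y hy
    refine ⟨fun w => if h : ∃ i, b i = w then b.repr y h.choose else 0, ?_, ?_⟩
    · intro i
      have h : ∃ j, b j = b i := ⟨i, rfl⟩
      simp only [dif_pos h]
      rw [b.injective h.choose_spec]
    · apply b.repr.injective
      ext i
      rw [repr_sum_smul b hb]
      have h : ∃ j, b j = b i := ⟨i, rfl⟩
      rw [dif_pos h, b.injective h.choose_spec]
      split_ifs with hi
      · rfl
      · exact hy i hi
  obtain ⟨c, hc, hσc⟩ := hexp (∑ w ∈ σ, w) fun i hi => ((hcoord i).2 hi).1
  obtain ⟨d, hd, hvd⟩ := hexp v fun i hi => ((hcoord i).2 hi).2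
  have hc0 : ∀ w ∈ B, 0 ≤ c w := by
    intro w hw
    obtain ⟨i, rfl⟩ := hb hw
    exact hc i ▸ (hcoord i).1
  have hrel : ∑ w ∈ σ, (1 : N → ℤ) w • w = ∑ w ∈ B, c w • w := by simpa using hσc
  have hσB : σ ⊆ B := by
    intro w hw
    by_contra hwB
    simpa using (coeff_eq_of_sum_eq hσ hB (fun _ _ => zero_le_one) hc0 hrel hw).1 hwB
  have hd0 : ∀ w ∈ B, w ∉ σ → 0 ≤ d w := by
    intro w hw hwσ
    have h0 : c w = 0 :=
      (coeff_eq_of_sum_eq hB hσ hc0 (fun _ _ => zero_le_one) hrel.symm hw).1 hwσ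
    obtain ⟨i, rfl⟩ := hb hw
    obtain ⟨t, ht, -⟩ := hS.exists_gt 0
    have := (repr_nonneg_of_mem_coneSpan b hb ht i).1
    rw [hrepr, ← hc i, h0, mul_zero, zero_add] at this
    exact hd i ▸ this
  obtain ⟨μ, hμ, hBμ⟩ := exists_maximal_of_mem hB
  refine ⟨μ, hμ, hσB.trans hBμ, fun w => if w ∈ B then d w else 0, ?_, fun w _ hwσ => ?_⟩
  · simp only [ite_smul, zero_smul, Finset.sum_ite_mem, Finset.inter_eq_right.2 hBμ]
    exact hvd
  · dsimp only
    split_ifs with h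
    · exact hd0 w h hwσ
    · exact le_rfl

theorem IsStarComplete.exists_eq_sum (hΔ : Δ.IsStarComplete) {μ : Finset N}
    (hμ : Maximal (fun A => A ∈ Δ.cones) μ) (v : N) : ∃ c : N → ℤ, v = ∑ w ∈ μ, c w • w := by
  obtain ⟨B, hB, hμB, c, hc, -⟩ := hΔ μ hμ.prop v
  exact ⟨c, by rwa [hμ.eq_of_le hB.prop hμB]⟩

theorem IsStarComplete.span_eq_top (hΔ : Δ.IsStarComplete) {μ : Finset N}
    (hμ : Maximal (fun A => A ∈ Δ.cones) μ) : Submodule.span ℤ (μ : Set N) = ⊤ := by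
  rw [eq_top_iff]
  rintro v -
  obtain ⟨c, rfl⟩ := hΔ.exists_eq_sum hμ v
  exact Submodule.sum_mem _ fun w hw => Submodule.smul_mem _ _ (Submodule.subset_span hw)

/-- The ray generators of a maximal cone of a complete fan form a basis of the lattice. -/
theorem IsStarComplete.exists_basis (hΔ : Δ.IsStarComplete) {μ : Finset N}
    (hμ : Maximal (fun A => A ∈ Δ.cones) μ) : ∃ b : Module.Basis μ ℤ N, ∀ v, b v = v := by
  have hli : LinearIndependent ℤ (Subtype.val : μ → N) := by
    obtain ⟨ι, b, hb⟩ := Δ.part_of_basis μ hμ.prop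
    have := b.linearIndependent.linearIndepOn_id.mono hb
    exact this
  exact ⟨Module.Basis.mk hli (by rw [Subtype.range_coe]; exact (hΔ.span_eq_top hμ).ge),
    fun v => by simp⟩

/-- A ray generator outside a maximal cone has a negative coordinate. -/
theorem IsStarComplete.exists_dual_neg (hΔ : Δ.IsStarComplete) {μ : Finset N}
    (hμ : Maximal (fun A => A ∈ Δ.cones) μ) {ρ : N} (hρ : ρ ∈ Δ.rays) (hρμ : ρ ∉ μ) :
    ∃ w ∈ dualMonoid μ, w ρ < 0 := by
  classical
  obtain ⟨c, hc⟩ := hΔ.exists_eq_sum hμ ρ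
  by_contra! hcon
  have hc0 : ∀ v ∈ μ, 0 ≤ c v := by
    intro v hv
    obtain ⟨u, hu⟩ := exists_dual_eq hμ.prop fun w => if w = v then 1 else 0
    have := hcon u fun w hw => by rw [hu w hw]; split_ifs <;> simp
    rw [hc, map_sum, Finset.sum_eq_single v] at this
    · simpa [hu v hv] using this
    · intro w hw hwv
      simp [hu w hw, hwv]
    · exact fun h => absurd hv h
  have hrel : ∑ v ∈ ({ρ} : Finset N), (1 : N → ℤ) v • v = ∑ v ∈ μ, c v • v := by simpa using hc
  simpa using (coeff_eq_of_sum_eq hρ hμ.prop (fun _ _ => zero_le_one) hc0 hrel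
    (Finset.mem_singleton_self ρ)).1 hρμ

theorem finite_rays : Δ.rays.Finite := by
  refine Set.Finite.of_finite_image (f := fun ρ => ({ρ} : Finset N)) ?_
    Finset.singleton_injective.injOn
  refine Δ.finite_cones.subset ?_
  rintro _ ⟨ρ, hρ, rfl⟩
  exact hρ

theorem mem_rays_of_mem {A : Finset N} (hA : A ∈ Δ.cones) {ρ : N} (hρ : ρ ∈ A) : ρ ∈ Δ.rays :=
  Δ.face_mem A hA _ (Finset.singleton_subset_iff.2 hρ)

end NonsingularFan
end ToricFano

namespace ToricFano

/-! ### The combinatorial equivalences -/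

namespace NonsingularFan

variable {N : Type} [AddCommGroup N] (Δ : NonsingularFan N)

/-- The numerical form of the ampleness of the anticanonical divisor of the star of `σ`, seen in
the fan itself.  The functional `u`, which vanishes on `σ` and is `1` on the other generators of a
maximal cone `μ`, is nonpositive on the remaining rays adjacent to `σ`. -/
def IsFanoAlong (σ : Finset N) : Prop :=
  ∀ μ, Maximal (fun A => A ∈ Δ.cones) μ → σ ⊆ μ → ∀ u : Module.Dual ℤ N, (∀ v ∈ σ, u v = 0) →
    (∀ v ∈ μ, v ∉ σ → u v = 1) → ∀ ρ, ρ ∉ μ → (∃ A ∈ Δ.cones, σ ⊆ A ∧ ρ ∈ A) → u ρ ≤ 0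

/-- Every ray generator is, modulo the lattice generated by the cone `σ`, zero or a ray generator
adjacent to `σ`. -/
def RaysReduceModulo (σ : Finset N) : Prop :=
  ∀ ρ ∈ Δ.rays, ∃ ρ', (ρ' = 0 ∨ ∃ A ∈ Δ.cones, σ ⊆ A ∧ ρ' ∈ A) ∧
    ρ - ρ' ∈ Submodule.span ℤ (σ : Set N)

/-- The condition on the coordinates of the ray generators with respect to maximal cones. -/
def HasSmallCoordinates : Prop :=
  ∀ μ : Finset N, Maximal (fun A => A ∈ Δ.cones) μ → ∀ ρ ∈ Δ.rays,
    ∃ b : N → ℤ, ρ = ∑ v ∈ μ, b v • v ∧ (∀ v ∈ μ, -1 ≤ b v ∧ b v ≤ 1) ∧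
      ∀ v ∈ μ, ∀ w ∈ μ, b v = 1 → b w = 1 → v = w

/-- The condition on the primitive relations. -/
def HasSmallPrimitiveSums : Prop :=
  ∀ P : Finset N, Δ.IsPrimitiveSet P → ∑ ρ ∈ P, ρ = 0 ∨ ∃ ρ' ∈ Δ.rays, ∑ ρ ∈ P, ρ = ρ'

variable {Δ}

theorem dual_eq_zero_of_mem_span {σ : Finset N} {u : Module.Dual ℤ N} (hu : ∀ v ∈ σ, u v = 0)
    {x : N} (hx : x ∈ Submodule.span ℤ (σ : Set N)) : u x = 0 := by
  have : Submodule.span ℤ (σ : Set N) ≤ LinearMap.ker u := Submodule.span_le.2 hu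
  exact this hx

theorem exists_bound_on_rays (u : Module.Dual ℤ N) : ∃ C : ℤ, ∀ ρ ∈ Δ.rays, u ρ ≤ C := by
  obtain ⟨C, hC⟩ := (finite_rays (Δ := Δ).image u).bddAbove
  exact ⟨C, fun ρ hρ => hC ⟨ρ, hρ, rfl⟩⟩

theorem exists_isPrimitiveSet_subset {A : Finset N} (hA : A ∉ Δ.cones)
    (hrays : ∀ ρ ∈ A, ρ ∈ Δ.rays) : ∃ P ⊆ A, Δ.IsPrimitiveSet P := by
  classical
  obtain ⟨P, hPA, hP⟩ := exists_minimal_le_of_wellFoundedLT (fun B => B ∉ Δ.cones) A hA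
  refine ⟨P, hPA, fun ρ hρ => hrays ρ (hPA hρ), hP.prop, fun ρ hρ => ?_⟩
  by_contra h
  exact Finset.notMem_erase ρ P (hP.le_of_le h (Finset.erase_subset ρ P) hρ)

/-- A ray generator `ρ` not adjacent to `σ` lies in a primitive set `P ⊆ {ρ} ∪ σ`, and `∑ P` is
congruent to `ρ` modulo `⟨σ⟩`.  Replacing `ρ` by `∑ P` increases a functional that is positive on
`σ`, so the procedure ends. -/
theorem HasSmallPrimitiveSums.raysReduceModulo (h : Δ.HasSmallPrimitiveSums) {σ : Finset N}
    (hσ : σ ∈ Δ.cones) : Δ.RaysReduceModulo σ := by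
  classical
  obtain ⟨u, hu⟩ := exists_dual_eq hσ fun _ => 1
  obtain ⟨C, hC⟩ := exists_bound_on_rays (Δ := Δ) u
  have key : ∀ n : ℕ, ∀ ρ ∈ Δ.rays, C - u ρ < n → ∃ ρ', (ρ' = 0 ∨ ∃ A ∈ Δ.cones, σ ⊆ A ∧ ρ' ∈ A) ∧
      ρ - ρ' ∈ Submodule.span ℤ (σ : Set N) := by
    intro n
    induction n with
    | zero =>
      intro ρ hρ hn
      have := hC ρ hρ
      push_cast at hn
      omega
    | succ n ih =>
      intro ρ hρ hn
      by_cases hcone : insert ρ σ ∈ Δ.cones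
      · exact ⟨ρ, Or.inr ⟨_, hcone, Finset.subset_insert _ _, Finset.mem_insert_self _ _⟩, by simp⟩
      obtain ⟨P, hPsub, hP⟩ := exists_isPrimitiveSet_subset hcone fun x hx => by
        rcases Finset.mem_insert.1 hx with rfl | hx
        · exact hρ
        · exact mem_rays_of_mem hσ hx
      have hρP : ρ ∈ P := by
        by_contra hn
        refine hP.2.1 (Δ.face_mem σ hσ P fun x hx => ?_)
        exact (Finset.mem_insert.1 (hPsub hx)).resolve_left fun h => hn (h ▸ hx)
      have hsub : P.erase ρ ⊆ σ := fun x hx =>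
        (Finset.mem_insert.1 (hPsub (Finset.mem_of_mem_erase hx))).resolve_left
          (Finset.ne_of_mem_erase hx)
      have hsum : ∑ x ∈ P, x = ρ + ∑ x ∈ P.erase ρ, x := (Finset.add_sum_erase P _ hρP).symm
      have hmem : ∑ x ∈ P.erase ρ, x ∈ Submodule.span ℤ (σ : Set N) :=
        Submodule.sum_mem _ fun x hx => Submodule.subset_span (hsub hx)
      have hne : (P.erase ρ).Nonempty := by
        rw [Finset.nonempty_iff_ne_empty]
        intro he
        have : P = {ρ} := by rw [← Finset.insert_erase hρP, he]; rfl
        exact hP.2.1 (this ▸ hρ)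
      have hu1 : u (∑ x ∈ P.erase ρ, x) = (P.erase ρ).card := by
        rw [map_sum, Finset.sum_congr rfl fun x hx => hu x (hsub hx)]
        simp
      have hpos := Finset.card_pos.2 hne
      rcases h P hP with h0 | ⟨τ, hτ, hPτ⟩
      · refine ⟨0, Or.inl rfl, ?_⟩
        rw [h0] at hsum
        rw [sub_zero, eq_neg_of_add_eq_zero_left hsum.symm]
        exact neg_mem hmem
      · have huτ : u τ = u ρ + (P.erase ρ).card := by rw [← hPτ, hsum, map_add, hu1]
        obtain ⟨ρ', hρ', hmem'⟩ := ih τ hτ (by push_cast at hn; omega)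
        refine ⟨ρ', hρ', ?_⟩
        have : ρ - ρ' = (τ - ρ') - ∑ x ∈ P.erase ρ, x := by rw [← hPτ, hsum]; abel
        rw [this]
        exact sub_mem hmem' hmem
  intro ρ hρ
  exact key ((C - u ρ).toNat + 1) ρ hρ (by push_cast; have := Int.self_le_toNat (C - u ρ); omega)

theorem sum_le_one_cases {ι : Type*} {s : Finset ι} {c : ι → ℤ} (hc : ∀ i ∈ s, 0 ≤ c i)
    (h : ∑ i ∈ s, c i ≤ 1) :
    (∀ i ∈ s, c i = 0) ∨ ∃ i ∈ s, c i = 1 ∧ ∀ j ∈ s, j ≠ i → c j = 0 := by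
  classical
  by_cases h0 : ∀ i ∈ s, c i = 0
  · exact Or.inl h0
  · push Not at h0
    obtain ⟨i, hi, hci⟩ := h0
    have h1 := Finset.add_sum_erase s c hi
    have h2 : 0 ≤ ∑ j ∈ s.erase i, c j :=
      Finset.sum_nonneg fun j hj => hc j (Finset.mem_of_mem_erase hj)
    have h3 := hc i hi
    refine Or.inr ⟨i, hi, by omega, fun j hj hji => ?_⟩
    have h4 : ∑ j ∈ s.erase i, c j = 0 := by omega
    exact (Finset.sum_eq_zero_iff_of_nonneg fun j hj => hc j (Finset.mem_of_mem_erase hj)).1 h4 j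
      (Finset.mem_erase.2 ⟨hji, hj⟩)

/-- In the star of `σ` a primitive pair has sum zero or a ray generator: the anticanonical degree
of its primitive relation is positive. -/
theorem IsFanoAlong.exists_add_sub_mem_span {σ : Finset N} (hF : Δ.IsFanoAlong σ)
    (hΔ : Δ.IsStarComplete) (hσ : σ ∈ Δ.cones) {τ w : N} (hτ : ∃ A ∈ Δ.cones, σ ⊆ A ∧ τ ∈ A)
    (hw : ∃ A ∈ Δ.cones, σ ⊆ A ∧ w ∈ A) (hτw : ¬ ∃ A ∈ Δ.cones, σ ⊆ A ∧ τ ∈ A ∧ w ∈ A) :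
    ∃ ρ', (ρ' = 0 ∨ ∃ A ∈ Δ.cones, σ ⊆ A ∧ ρ' ∈ A) ∧
      τ + w - ρ' ∈ Submodule.span ℤ (σ : Set N) := by
  classical
  obtain ⟨B, hB, hσB, c, hc, hc0⟩ := hΔ σ hσ (τ + w)
  obtain ⟨u, hu⟩ := exists_dual_eq hB.prop fun v => if v ∈ σ then 0 else 1
  have hu0 : ∀ v ∈ σ, u v = 0 := fun v hv => by rw [hu v (hσB hv), if_pos hv]
  have hu1 : ∀ v ∈ B, v ∉ σ → u v = 1 := fun v hv hvσ => by rw [hu v hv, if_neg hvσ]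
  have hle : ∀ x, x ∈ B → u x ≤ 1 := fun x hx => by rw [hu x hx]; split_ifs <;> simp
  have hle0 : ∀ x, x ∉ B → (∃ A ∈ Δ.cones, σ ⊆ A ∧ x ∈ A) → u x ≤ 0 :=
    hF B hB hσB u hu0 hu1
  have hsum : u (τ + w) ≤ 1 := by
    rw [map_add]
    by_cases h1 : τ ∈ B
    · have h2 : w ∉ B := fun h2 => hτw ⟨B, hB.prop, hσB, h1, h2⟩
      have := hle τ h1
      have := hle0 w h2 hw
      omega
    · have := hle0 τ h1 hτ
      by_cases h2 : w ∈ B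
      · have := hle w h2
        omega
      · have := hle0 w h2 hw
        omega
  have hsplit : τ + w = ∑ v ∈ σ, c v • v + ∑ v ∈ B \ σ, c v • v := by
    rw [hc, add_comm, Finset.sum_sdiff hσB]
  have hmem : ∑ v ∈ σ, c v • v ∈ Submodule.span ℤ (σ : Set N) :=
    Submodule.sum_mem _ fun v hv => Submodule.smul_mem _ _ (Submodule.subset_span hv)
  have husum : u (τ + w) = ∑ v ∈ B \ σ, c v := by
    rw [hsplit, map_add, dual_eq_zero_of_mem_span hu0 hmem, zero_add, map_sum]
    refine Finset.sum_congr rfl fun v hv => ?_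
    rw [map_smul, hu1 v (Finset.mem_sdiff.1 hv).1 (Finset.mem_sdiff.1 hv).2, smul_eq_mul, mul_one]
  rcases sum_le_one_cases (s := B \ σ) (c := c)
    (fun v hv => hc0 v (Finset.mem_sdiff.1 hv).1 (Finset.mem_sdiff.1 hv).2) (husum ▸ hsum) with
    h | ⟨v, hv, hcv, hrest⟩
  · refine ⟨0, Or.inl rfl, ?_⟩
    rwa [hsplit, Finset.sum_eq_zero (s := B \ σ) fun v hv => by rw [h v hv, zero_smul], add_zero,
      sub_zero]
  · refine ⟨v, Or.inr ⟨B, hB.prop, hσB, (Finset.mem_sdiff.1 hv).1⟩, ?_⟩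
    rwa [hsplit, Finset.sum_eq_single_of_mem v hv fun x hx hxv => by rw [hrest x hx hxv, zero_smul],
      hcv, one_smul, add_sub_cancel_right]

/-- Reduction modulo one further generator `w` adds multiples of `w`, staying among the rays of
the star already reached. -/
theorem raysReduceModulo_of_isFanoAlong (hΔ : Δ.IsStarComplete)
    (hF : ∀ σ ∈ Δ.cones, Δ.IsFanoAlong σ) {σ : Finset N} (hσ : σ ∈ Δ.cones) :
    Δ.RaysReduceModulo σ := by
  classical
  induction σ using Finset.induction_on with
  | empty =>
    exact fun ρ hρ => ⟨ρ, Or.inr ⟨{ρ}, hρ, Finset.empty_subset _, Finset.mem_singleton_self _⟩,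
      by simp⟩
  | insert w σ hwσ IH =>
    have hσ' : σ ∈ Δ.cones := Δ.face_mem _ hσ _ (Finset.subset_insert _ _)
    have hspan : Submodule.span ℤ (σ : Set N) ≤
        Submodule.span ℤ ((insert w σ : Finset N) : Set N) :=
      Submodule.span_mono (Finset.coe_subset.2 (Finset.subset_insert _ _))
    have hwspan : w ∈ Submodule.span ℤ ((insert w σ : Finset N) : Set N) :=
      Submodule.subset_span (Finset.mem_coe.2 (Finset.mem_insert_self _ _))
    obtain ⟨u, hu⟩ := exists_dual_eq hσ fun v => if v = w then 1 else 0
    have hu0 : ∀ v ∈ σ, u v = 0 := fun v hv => by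
      rw [hu v (Finset.mem_insert_of_mem hv), if_neg (by rintro rfl; exact hwσ hv)]
    have huw : u w = 1 := by rw [hu w (Finset.mem_insert_self _ _), if_pos rfl]
    obtain ⟨C, hC⟩ := exists_bound_on_rays (Δ := Δ) u
    have key : ∀ n : ℕ, ∀ τ, (∃ A ∈ Δ.cones, σ ⊆ A ∧ τ ∈ A) → C - u τ < n →
        ∃ ρ', (ρ' = 0 ∨ ∃ A ∈ Δ.cones, insert w σ ⊆ A ∧ ρ' ∈ A) ∧
          τ - ρ' ∈ Submodule.span ℤ ((insert w σ : Finset N) : Set N) := by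
      intro n
      induction n with
      | zero =>
        rintro τ ⟨A, hA, -, hτ⟩ hn
        have := hC τ (mem_rays_of_mem hA hτ)
        push_cast at hn
        omega
      | succ n ih =>
        intro τ hτ hn
        by_cases hτw : ∃ A ∈ Δ.cones, σ ⊆ A ∧ τ ∈ A ∧ w ∈ A
        · obtain ⟨A, hA, h1, h2, h3⟩ := hτw
          exact ⟨τ, Or.inr ⟨A, hA, Finset.insert_subset h3 h1, h2⟩, by simp⟩
        · obtain ⟨τ', hτ', hmem⟩ := (hF σ hσ').exists_add_sub_mem_span hΔ hσ' hτ
            ⟨_, hσ, Finset.subset_insert _ _, Finset.mem_insert_self _ _⟩ hτw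
          rcases hτ' with rfl | hτ'
          · refine ⟨0, Or.inl rfl, ?_⟩
            have : τ - 0 = (τ + w - 0) - w := by abel
            rw [this]
            exact sub_mem (hspan hmem) hwspan
          · have h0 := dual_eq_zero_of_mem_span hu0 hmem
            rw [map_sub, map_add, huw] at h0
            obtain ⟨ρ', hρ', hmem'⟩ := ih τ' hτ' (by push_cast at hn; omega)
            refine ⟨ρ', hρ', ?_⟩
            have : τ - ρ' = (τ + w - τ') - w + (τ' - ρ') := by abel
            rw [this]
            exact add_mem (sub_mem (hspan hmem) hwspan) hmem'
    intro ρ hρ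
    obtain ⟨τ, hτ, hmem⟩ := IH hσ' ρ hρ
    rcases hτ with rfl | hτ
    · exact ⟨0, Or.inl rfl, hspan hmem⟩
    · obtain ⟨ρ', hρ', hmem'⟩ := key ((C - u τ).toNat + 1) τ hτ
        (by push_cast; have := Int.self_le_toNat (C - u τ); omega)
      exact ⟨ρ', hρ', by rw [← sub_add_sub_cancel ρ τ ρ']; exact add_mem (hspan hmem) hmem'⟩

/-- The coordinates of `ρ` with respect to `μ` at `v`, and at a pair `v, w`, are those of the
reduction of `ρ` modulo the other generators; that reduction lives in the star of a wall (the fan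
of a projective line), respectively in a complete two-dimensional fan. -/
theorem hasSmallCoordinates_of_raysReduceModulo (hΔ : Δ.IsStarComplete)
    (h : ∀ σ ∈ Δ.cones, Δ.RaysReduceModulo σ) : Δ.HasSmallCoordinates := by
  classical
  intro μ hμ ρ hρ
  obtain ⟨b, hb⟩ := hΔ.exists_eq_sum hμ ρ
  choose f hf using fun v : N => exists_dual_eq hμ.prop fun w => if w = v then 1 else 0
  have hfsum : ∀ (c : N → ℤ) (v), v ∈ μ → f v (∑ w ∈ μ, c w • w) = c v := by
    intro c v hv
    rw [map_sum, Finset.sum_eq_single v]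
    · rw [map_smul, hf v v hv, if_pos rfl, smul_eq_mul, mul_one]
    · intro w hw hwv
      rw [map_smul, hf v w hw, if_neg hwv, smul_zero]
    · exact fun h => absurd hv h
  have hfρ : ∀ v ∈ μ, f v ρ = b v := fun v hv => by rw [hb, hfsum b v hv]
  refine ⟨b, hb, fun v hv => ?_, fun v hv w hw hbv hbw => ?_⟩
  · have hσ : μ.erase v ∈ Δ.cones := Δ.face_mem _ hμ.prop _ (Finset.erase_subset _ _)
    have hf0 : ∀ x ∈ μ.erase v, f v x = 0 := fun x hx => by
      rw [hf v x (Finset.mem_of_mem_erase hx), if_neg (Finset.ne_of_mem_erase hx)]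
    obtain ⟨ρ', hρ', hmem⟩ := h _ hσ ρ hρ
    have e := dual_eq_zero_of_mem_span hf0 hmem
    rw [map_sub, hfρ v hv, sub_eq_zero] at e
    rcases hρ' with rfl | ⟨A, hA, hσA, hρ'A⟩
    · rw [e, map_zero]
      omega
    by_cases hρ'σ : ρ' ∈ μ.erase v
    · rw [e, hf0 ρ' hρ'σ]
      omega
    obtain ⟨g, hg⟩ := exists_dual_eq hA fun x => if x = ρ' then 1 else 0
    have hg0 : ∀ x ∈ μ.erase v, g x = 0 := fun x hx => by
      rw [hg x (hσA hx), if_neg (by rintro rfl; exact hρ'σ hx)]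
    have hg1 : g ρ' = 1 := by rw [hg ρ' hρ'A, if_pos rfl]
    obtain ⟨c, hc⟩ := hΔ.exists_eq_sum hμ ρ'
    have hprod : c v * g v = 1 := by
      rw [← hg1]
      conv_rhs => rw [hc, map_sum]
      rw [Finset.sum_eq_single v]
      · rw [map_smul, smul_eq_mul]
      · intro x hx hxv
        rw [map_smul, hg0 x (Finset.mem_erase.2 ⟨hxv, hx⟩), smul_zero]
      · exact fun h => absurd hv h
    have hcv : b v = c v := by rw [e, hc, hfsum c v hv]
    rw [hcv]
    rcases Int.isUnit_iff.1 (IsUnit.of_mul_eq_one _ hprod) with h | h <;> omega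
  · by_contra hvw
    let σ := (μ.erase v).erase w
    have hσμ : σ ⊆ μ := (Finset.erase_subset _ _).trans (Finset.erase_subset _ _)
    have hσ : σ ∈ Δ.cones := Δ.face_mem _ hμ.prop _ hσμ
    have hσv : ∀ x ∈ σ, x ≠ v := fun x hx => Finset.ne_of_mem_erase (Finset.mem_of_mem_erase hx)
    have hσw : ∀ x ∈ σ, x ≠ w := fun x hx => Finset.ne_of_mem_erase hx
    obtain ⟨ρ', hρ', hmem⟩ := h _ hσ ρ hρ
    have ev := dual_eq_zero_of_mem_span (u := f v)
      (fun x hx => by rw [hf v x (hσμ hx), if_neg (hσv x hx)]) hmem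
    have ew := dual_eq_zero_of_mem_span (u := f w)
      (fun x hx => by rw [hf w x (hσμ hx), if_neg (hσw x hx)]) hmem
    rw [map_sub, hfρ v hv, hbv, sub_eq_zero] at ev
    rw [map_sub, hfρ w hw, hbw, sub_eq_zero] at ew
    rcases hρ' with rfl | ⟨A, hA, hσA, hρ'A⟩
    · simp at ev
    by_cases hρ'μ : ρ' ∈ μ
    · rw [hf v ρ' hρ'μ] at ev
      rw [hf w ρ' hρ'μ] at ew
      have h1 : ρ' = v := by by_contra h; simp [h] at ev
      have h2 : ρ' = w := by by_contra h; simp [h] at ew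
      exact hvw (h1.symm.trans h2)
    obtain ⟨c, hc⟩ := hΔ.exists_eq_sum hμ ρ'
    have hcv : c v = 1 := by rw [← hfsum c v hv, ← hc, ev]
    have hcw : c w = 1 := by rw [← hfsum c w hw, ← hc, ew]
    have hmμ : ∀ x ∈ μ, x ∉ σ → x = v ∨ x = w := by
      intro x hx hxσ
      by_contra! hne
      exact hxσ (Finset.mem_erase.2 ⟨hne.2, Finset.mem_erase.2 ⟨hne.1, hx⟩⟩)
    -- Moving the negative coefficients to the left gives two expressions of one lattice point.
    have hrel : ∑ x ∈ A, ((if x ∈ σ then (c x)⁻ else 0) + if x = ρ' then 1 else 0) • x =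
        ∑ x ∈ μ, (c x)⁺ • x := by
      simp only [add_smul, ite_smul, zero_smul, one_smul, Finset.sum_add_distrib,
        Finset.sum_ite_eq', hρ'A, if_true, Finset.sum_ite_mem, Finset.inter_eq_right.2 hσA]
      have h1 : ∑ x ∈ σ, (c x)⁻ • x = ∑ x ∈ μ, (c x)⁻ • x := by
        refine Finset.sum_subset hσμ fun x hx hxσ => ?_
        rcases hmμ x hx hxσ with rfl | rfl
        · simp [hcv]
        · simp [hcw]
      rw [h1]
      conv_lhs => rw [hc]
      rw [← Finset.sum_add_distrib]
      exact Finset.sum_congr rfl fun x _ => by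
        rw [← add_smul, add_comm, ← sub_eq_iff_eq_add.1 (posPart_sub_negPart (c x))]
    have := (coeff_eq_of_sum_eq hA hμ.prop (fun x _ => by split_ifs <;> positivity)
      (fun x _ => by positivity) hrel hρ'A).1 hρ'μ
    have hρ'σ : ρ' ∉ σ := fun h => hρ'μ (hσμ h)
    simp [hρ'σ] at this

/-- A ray generator adjacent to `σ` and outside the maximal cone `μ` has a negative coordinate off
`σ`, which outweighs the at most one coordinate equal to `1`. -/
theorem HasSmallCoordinates.isFanoAlong (h : Δ.HasSmallCoordinates) {σ : Finset N} :
    Δ.IsFanoAlong σ := by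
  classical
  rintro μ hμ hσμ u hu0 hu1 ρ hρμ ⟨A, hA, hσA, hρA⟩
  obtain ⟨b, hb, hb1, hb2⟩ := h μ hμ ρ (mem_rays_of_mem hA hρA)
  have huρ : u ρ = ∑ v ∈ μ \ σ, b v := by
    rw [hb, map_sum, ← Finset.sum_sdiff hσμ, Finset.sum_eq_zero (s := σ), add_zero]
    · refine Finset.sum_congr rfl fun v hv => ?_
      rw [map_smul, hu1 v (Finset.mem_sdiff.1 hv).1 (Finset.mem_sdiff.1 hv).2, smul_eq_mul, mul_one]
    · intro v hv
      rw [map_smul, hu0 v hv, smul_zero]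
  have hneg : ∃ v ∈ μ \ σ, b v < 0 := by
    -- Otherwise `ρ` plus a nonnegative combination of the generators of `σ` would lie in the cone
    -- of `μ`, which is impossible for `ρ ∉ μ`.
    by_contra! hcon
    have hρσ : ρ ∉ σ := fun h => hρμ (hσμ h)
    have hrel : ∑ x ∈ A, ((if x ∈ σ then (b x)⁻ else 0) + if x = ρ then 1 else 0) • x =
        ∑ x ∈ μ, (b x)⁺ • x := by
      simp only [add_smul, ite_smul, zero_smul, one_smul, Finset.sum_add_distrib,
        Finset.sum_ite_eq', hρA, if_true, Finset.sum_ite_mem, Finset.inter_eq_right.2 hσA]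
      have h1 : ∑ x ∈ σ, (b x)⁻ • x = ∑ x ∈ μ, (b x)⁻ • x := by
        refine Finset.sum_subset hσμ fun x hx hxσ => ?_
        rw [negPart_eq_zero.2 (hcon x (Finset.mem_sdiff.2 ⟨hx, hxσ⟩)), zero_smul]
      rw [h1]
      conv_lhs => rw [hb]
      rw [← Finset.sum_add_distrib]
      exact Finset.sum_congr rfl fun x _ => by
        rw [← add_smul, add_comm, ← sub_eq_iff_eq_add.1 (posPart_sub_negPart (b x))]
    have := (coeff_eq_of_sum_eq hA hμ.prop (fun x _ => by split_ifs <;> positivity)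
      (fun x _ => by positivity) hrel hρA).1 hρμ
    simp [hρσ] at this
  obtain ⟨v, hv, hbv⟩ := hneg
  rw [huρ, ← Finset.add_sum_erase _ _ hv]
  suffices ∑ x ∈ (μ \ σ).erase v, b x ≤ 1 by omega
  have hmem : ∀ x ∈ (μ \ σ).erase v, x ∈ μ := fun x hx =>
    (Finset.mem_sdiff.1 (Finset.mem_of_mem_erase hx)).1
  by_cases h1 : ∃ w ∈ (μ \ σ).erase v, b w = 1
  · obtain ⟨w, hw, hbw⟩ := h1
    rw [← Finset.add_sum_erase _ _ hw, hbw]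
    have : ∑ x ∈ ((μ \ σ).erase v).erase w, b x ≤ 0 := by
      refine Finset.sum_nonpos fun x hx => ?_
      have hx' := hmem x (Finset.mem_of_mem_erase hx)
      have h2 := (hb1 x hx').2
      have h3 : b x ≠ 1 := fun h => Finset.ne_of_mem_erase hx (hb2 x hx' w (hmem w hw) h hbw)
      omega
    omega
  · push Not at h1
    have : ∑ x ∈ (μ \ σ).erase v, b x ≤ 0 := by
      refine Finset.sum_nonpos fun x hx => ?_
      have h2 := (hb1 x (hmem x hx)).2
      have h3 := h1 x hx
      omega
    omega

/-- For `ρ ∈ P`, write `∑ P` in a maximal cone containing `P ∖ {ρ}` whose coordinates outside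
`P ∖ {ρ}` are nonnegative.  All its coordinates are nonnegative by the bound on those of `ρ`, and
those at elements of `P` vanish since `P` does not generate a cone. -/
theorem HasSmallCoordinates.hasSmallPrimitiveSums (h : Δ.HasSmallCoordinates)
    (hΔ : Δ.IsStarComplete) : Δ.HasSmallPrimitiveSums := by
  classical
  intro P hP
  obtain ⟨ρ, hρP⟩ : P.Nonempty := by
    rw [Finset.nonempty_iff_ne_empty]
    rintro rfl
    obtain ⟨A, hA⟩ := Δ.nonempty_cones
    exact hP.2.1 (Δ.face_mem A hA _ (Finset.empty_subset _))
  obtain ⟨B, hB, hQB, c, hc, hc0⟩ := hΔ _ (hP.2.2 ρ hρP) (∑ x ∈ P, x)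
  obtain ⟨b, hb, hb1, hb2⟩ := h B hB ρ (hP.1 ρ hρP)
  have hcb : ∀ x ∈ B, c x = b x + if x ∈ P.erase ρ then 1 else 0 := by
    intro x hx
    obtain ⟨f, hf⟩ := exists_dual_eq hB.prop fun w => if w = x then 1 else 0
    have hfsum : ∀ d : N → ℤ, f (∑ w ∈ B, d w • w) = d x := by
      intro d
      rw [map_sum, Finset.sum_eq_single x]
      · rw [map_smul, hf x hx, if_pos rfl, smul_eq_mul, mul_one]
      · intro w hw hwv
        rw [map_smul, hf w hw, if_neg hwv, smul_zero]
      · exact fun h => absurd hx h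
    have e : ∑ w ∈ B, c w • w = ∑ w ∈ B, (b w + if w ∈ P.erase ρ then 1 else 0) • w := by
      simp only [add_smul, ite_smul, zero_smul, one_smul, Finset.sum_add_distrib,
        Finset.sum_ite_mem, Finset.inter_eq_right.2 hQB]
      rw [← hc, ← hb, Finset.add_sum_erase P (fun x => x) hρP]
    have := congrArg f e
    rwa [hfsum, hfsum] at this
  have hcnn : ∀ x ∈ B, 0 ≤ c x := by
    intro x hx
    by_cases hxQ : x ∈ P.erase ρ
    · rw [hcb x hx, if_pos hxQ]
      have := (hb1 x hx).1
      omega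
    · exact hc0 x hx hxQ
  have hcP : ∀ x ∈ B, x ∈ P → c x = 0 := by
    intro x hx hxP
    by_contra hne
    have hrel : ∑ w ∈ P.erase x, (1 : N → ℤ) w • w =
        ∑ w ∈ B, (c w - if w = x then 1 else 0) • w := by
      simp only [sub_smul, ite_smul, zero_smul, one_smul, Finset.sum_sub_distrib,
        Finset.sum_ite_eq', hx, if_true, Pi.one_apply]
      rw [← hc, ← Finset.add_sum_erase P (fun x => x) hxP, add_sub_cancel_left]
    have hsub : P.erase x ⊆ B := by
      intro w hw
      by_contra hwB
      simpa using (coeff_eq_of_sum_eq (hP.2.2 x hxP) hB.prop (fun _ _ => zero_le_one)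
        (fun y hy => by
          have := hcnn y hy
          split_ifs with hyx
          · subst hyx; omega
          · omega) hrel hw).1 hwB
    refine hP.2.1 (Δ.face_mem B hB.prop P fun w hw => ?_)
    by_cases hwx : w = x
    · exact hwx ▸ hx
    · exact hsub (Finset.mem_erase.2 ⟨hwx, hw⟩)
  have hcb' : ∀ x ∈ B, c x ≠ 0 → c x = 1 ∧ b x = 1 := by
    intro x hx hne
    have h1 := hcb x hx
    rw [if_neg fun h => hne (hcP x hx (Finset.mem_of_mem_erase h)), add_zero] at h1
    have h2 := (hb1 x hx).2
    have h3 := hcnn x hx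
    omega
  by_cases hall : ∀ x ∈ B, c x = 0
  · left
    rw [hc]
    exact Finset.sum_eq_zero fun x hx => by rw [hall x hx, zero_smul]
  · right
    push Not at hall
    obtain ⟨x, hx, hne⟩ := hall
    refine ⟨x, mem_rays_of_mem hB.prop hx, ?_⟩
    rw [hc, Finset.sum_eq_single_of_mem x hx, (hcb' x hx hne).1, one_smul]
    intro y hy hyx
    by_contra hy0
    have hcy : c y ≠ 0 := fun h => hy0 (by rw [h, zero_smul])
    exact hyx (hb2 y hy x hx (hcb' y hy hcy).2 (hcb' x hx hne).2)

end NonsingularFan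
end ToricFano

namespace ToricFano

/-! ### The numerical Fano condition and the stars of the fan -/

namespace NonsingularFan

variable {N : Type} [AddCommGroup N] {Δ : NonsingularFan N}

variable (Δ) in
/-- The numerical form of the ampleness of the anticanonical divisor: the functional that is `1` on
the generators of a maximal cone is nonpositive on all other ray generators. -/
def IsNumericallyFano : Prop :=
  ∀ μ, Maximal (fun A => A ∈ Δ.cones) μ → ∀ u : Module.Dual ℤ N, (∀ v ∈ μ, u v = 1) →
    ∀ ρ ∈ Δ.rays, ρ ∉ μ → u ρ ≤ 0

theorem isNumericallyFano_of_isFanoAlong_empty (h : Δ.IsFanoAlong ∅) : Δ.IsNumericallyFano :=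
  fun μ hμ u hu ρ hρ hρμ => h μ hμ (Finset.empty_subset _) u (by simp) (fun v hv _ => hu v hv) ρ hρμ
    ⟨{ρ}, hρ, Finset.empty_subset _, Finset.mem_singleton_self _⟩

/-- The generators of a cone of the star are the images of those of a cone containing `σ`, and
the remaining generators of that cone map injectively. -/
theorem injOn_mkQ_sdiff {σ A : Finset N} (hA : A ∈ Δ.cones) (hσA : σ ⊆ A) :
    Set.InjOn (Submodule.span ℤ (σ : Set N)).mkQ ((A : Set N) \ (σ : Set N)) := by
  intro v hv w hw h
  exact eq_of_sub_mem_span hA hA hσA hσA hv.1 hv.2 hw.1 ((Submodule.Quotient.eq _).1 h)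

open Classical in
theorem image_mem_starFan {σ A : Finset N} (hσ : σ ∈ Δ.cones) (hA : A ∈ Δ.cones) (hσA : σ ⊆ A) :
    (A \ σ).image (Submodule.span ℤ (σ : Set N)).mkQ ∈ (Δ.starFan σ hσ).cones :=
  ⟨A, hA, hσA, by simp⟩

open Classical in
theorem maximal_image_starFan {σ A : Finset N} (hσ : σ ∈ Δ.cones)
    (hA : Maximal (fun A => A ∈ Δ.cones) A) (hσA : σ ⊆ A) :
    Maximal (fun B => B ∈ (Δ.starFan σ hσ).cones)
      ((A \ σ).image (Submodule.span ℤ (σ : Set N)).mkQ) := by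
  refine ⟨image_mem_starFan hσ hA.prop hσA, ?_⟩
  rintro B ⟨A', hA', hσA', hB⟩ hle
  have hAA' : A ⊆ A' := by
    intro v hv
    by_cases hvσ : v ∈ σ
    · exact hσA' hvσ
    have : (Submodule.span ℤ (σ : Set N)).mkQ v ∈ (B : Set _) :=
      hle (Finset.mem_image_of_mem _ (Finset.mem_sdiff.2 ⟨hv, hvσ⟩))
    rw [hB] at this
    obtain ⟨w, ⟨hw, -⟩, hwv⟩ := this
    rw [eq_of_sub_mem_span hA.prop hA' hσA hσA' hv hvσ hw ((Submodule.Quotient.eq _).1 hwv.symm)]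
    exact hw
  obtain rfl : A = A' := hA.eq_of_le hA' hAA'
  intro x hx
  have : x ∈ (B : Set _) := hx
  rw [hB] at this
  simpa using this

theorem exists_maximal_of_maximal_starFan {σ : Finset N} (hσ : σ ∈ Δ.cones)
    {B : Finset (N ⧸ Submodule.span ℤ (σ : Set N))}
    (hB : Maximal (fun B => B ∈ (Δ.starFan σ hσ).cones) B) :
    ∃ A, Maximal (fun A => A ∈ Δ.cones) A ∧ σ ⊆ A ∧
      (B : Set _) = (Submodule.span ℤ (σ : Set N)).mkQ '' ((A : Set N) \ (σ : Set N)) := by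
  classical
  obtain ⟨A, hA, hσA, hBA⟩ := hB.prop
  obtain ⟨A', hA', hAA'⟩ := exists_maximal_of_mem hA
  refine ⟨A', hA', hσA.trans hAA', ?_⟩
  have hle : B ≤ (A' \ σ).image (Submodule.span ℤ (σ : Set N)).mkQ := by
    intro x hx
    have : x ∈ (B : Set _) := hx
    rw [hBA] at this
    obtain ⟨v, hv, rfl⟩ := this
    exact Finset.mem_image_of_mem _ (Finset.mem_sdiff.2 ⟨hAA' hv.1, hv.2⟩)
  rw [hB.eq_of_le (image_mem_starFan hσ hA'.prop (hσA.trans hAA')) hle]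
  simp

theorem IsStarComplete.starFan (hΔ : Δ.IsStarComplete) {σ : Finset N} (hσ : σ ∈ Δ.cones) :
    (Δ.starFan σ hσ).IsStarComplete := by
  classical
  rintro B ⟨A, hA, hσA, hB⟩ x
  obtain ⟨v, rfl⟩ := Submodule.mkQ_surjective _ x
  obtain ⟨μ, hμ, hAμ, c, hc, hc0⟩ := hΔ A hA v
  have hσμ := hσA.trans hAμ
  have hinj := injOn_mkQ_sdiff hμ.prop hσμ
  let s := Function.invFunOn (Submodule.span ℤ (σ : Set N)).mkQ ((μ : Set N) \ (σ : Set N))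
  have hs : ∀ w ∈ μ \ σ, s ((Submodule.span ℤ (σ : Set N)).mkQ w) = w := fun w hw =>
    hinj.leftInvOn_invFunOn (by simpa using hw)
  refine ⟨_, maximal_image_starFan hσ hμ hσμ, ?_, c ∘ s, ?_, ?_⟩
  · intro y hy
    have : y ∈ (B : Set _) := hy
    rw [hB] at this
    obtain ⟨w, hw, rfl⟩ := this
    exact Finset.mem_image_of_mem _ (Finset.mem_sdiff.2 ⟨hAμ hw.1, hw.2⟩)
  · rw [Finset.sum_image fun w hw w' hw' h => hinj (by simpa using hw) (by simpa using hw') h,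
      hc, ← Finset.sum_sdiff hσμ, map_add, map_sum, map_sum, Finset.sum_eq_zero (s := σ), add_zero]
    · exact Finset.sum_congr rfl fun w hw => by rw [Function.comp, hs w hw, map_smul]
    · intro w hw
      have : (Submodule.span ℤ (σ : Set N)).mkQ w = 0 :=
        (Submodule.Quotient.mk_eq_zero _).2 (Submodule.subset_span hw)
      rw [map_smul, this, smul_zero]
  · intro y hy hyB
    obtain ⟨w, hw, rfl⟩ := Finset.mem_image.1 hy
    rw [Function.comp, hs w hw]
    refine hc0 w (Finset.mem_sdiff.1 hw).1 fun hwA => hyB ?_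
    rw [← Finset.mem_coe, hB]
    exact ⟨w, ⟨hwA, (Finset.mem_sdiff.1 hw).2⟩, rfl⟩

theorem isNumericallyFano_starFan_iff {σ : Finset N} (hσ : σ ∈ Δ.cones) :
    (Δ.starFan σ hσ).IsNumericallyFano ↔ Δ.IsFanoAlong σ := by
  classical
  constructor
  · rintro h μ hμ hσμ u hu0 hu1 ρ hρμ ⟨A, hA, hσA, hρA⟩
    have hle : Submodule.span ℤ (σ : Set N) ≤ LinearMap.ker u := Submodule.span_le.2 hu0
    refine h _ (maximal_image_starFan hσ hμ hσμ) ((Submodule.span ℤ (σ : Set N)).liftQ u hle) ?_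
      ((Submodule.span ℤ (σ : Set N)).mkQ ρ) ?_ ?_
    · intro x hx
      obtain ⟨v, hv, rfl⟩ := Finset.mem_image.1 hx
      exact hu1 v (Finset.mem_sdiff.1 hv).1 (Finset.mem_sdiff.1 hv).2
    · exact mem_rays_of_mem (image_mem_starFan hσ hA hσA)
        (Finset.mem_image_of_mem _ (Finset.mem_sdiff.2 ⟨hρA, fun h => hρμ (hσμ h)⟩))
    · intro hx
      obtain ⟨v, hv, hvρ⟩ := Finset.mem_image.1 hx
      have := eq_of_sub_mem_span hμ.prop hA hσμ hσA (Finset.mem_sdiff.1 hv).1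
        (Finset.mem_sdiff.1 hv).2 hρA ((Submodule.Quotient.eq _).1 hvρ)
      exact hρμ (this ▸ (Finset.mem_sdiff.1 hv).1)
  · intro h B hB u hu x hx hxB
    obtain ⟨μ, hμ, hσμ, hBμ⟩ := exists_maximal_of_maximal_starFan hσ hB
    obtain ⟨A, hA, hσA, hxA⟩ := hx
    obtain ⟨ρ, ⟨hρA, hρσ⟩, rfl⟩ : x ∈ (Submodule.span ℤ (σ : Set N)).mkQ ''
        ((A : Set N) \ (σ : Set N)) := hxA ▸ by simp
    refine h μ hμ hσμ (u ∘ₗ (Submodule.span ℤ (σ : Set N)).mkQ) ?_ ?_ ρ ?_ ⟨A, hA, hσA, hρA⟩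
    · intro v hv
      have : (Submodule.span ℤ (σ : Set N)).mkQ v = 0 :=
        (Submodule.Quotient.mk_eq_zero _).2 (Submodule.subset_span hv)
      rw [LinearMap.comp_apply, this, map_zero]
    · intro v hv hvσ
      refine hu _ ?_
      rw [← Finset.mem_coe, hBμ]
      exact ⟨v, ⟨hv, hvσ⟩, rfl⟩
    · intro hρμ
      refine hxB ?_
      rw [← Finset.mem_coe, hBμ]
      exact ⟨ρ, ⟨hρμ, hρσ⟩, rfl⟩

end NonsingularFan
end ToricFano

namespace ToricFano

/-! ### Top differential forms on the function field of a torus -/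

section ExteriorPower

variable {K V : Type*} [Field K] [AddCommGroup V] [Module K V] {n : ℕ}

theorem ιMulti_eq_det_smul (β : Module.Basis (Fin n) K V) (v : Fin n → V) :
    exteriorPower.ιMulti K n v = β.det v • exteriorPower.ιMulti K n β := by
  have : exteriorPower.ιMulti K n (M := V) =
      (LinearMap.toSpanSingleton K _ (exteriorPower.ιMulti K n β)).compAlternatingMap β.det := by
    refine β.ext_alternating fun σ hσ => ?_
    let τ : Equiv.Perm (Fin n) := Equiv.ofBijective σ (Finite.injective_iff_bijective.1 hσ)
    have h1 : (fun i => β (σ i)) = β ∘ τ := rfl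
    rw [h1, AlternatingMap.map_perm, LinearMap.compAlternatingMap_apply, AlternatingMap.map_perm,
      β.det_self]
    simp [LinearMap.toSpanSingleton_apply]
  exact DFunLike.congr_fun this v

/-- The linear form on the top exterior power that takes the value `1` at the wedge product of the
basis vectors. -/
theorem exists_dual_ιMulti_eq_one (β : Module.Basis (Fin n) K V) :
    ∃ l : ⋀[K]^n V →ₗ[K] K, l (exteriorPower.ιMulti K n β) = 1 :=
  ⟨exteriorPower.alternatingMapLinearEquiv β.det, by
    rw [exteriorPower.alternatingMapLinearEquiv_apply_ιMulti, β.det_self]⟩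

end ExteriorPower

section TorusField

open Module

variable {N : Type} [AddCommGroup N] {K : Type} [Field K] [Algebra ℂ K]

/-- The embedding `Φ` identifies `K` with the field of fractions of the coordinate ring `ℂ[M]` of
the torus. -/
structure IsTorusField (Φ : AddMonoidAlgebra ℂ (Dual ℤ N) →ₐ[ℂ] K) : Prop where
  injective : Function.Injective Φ
  exists_div : ∀ z, ∃ f g, z = Φ f / Φ g

/-- The character `χ^w` of the torus, as an element of the function field. -/
noncomputable def character (Φ : AddMonoidAlgebra ℂ (Dual ℤ N) →ₐ[ℂ] K) (w : Dual ℤ N) : K :=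
  Φ (AddMonoidAlgebra.single w 1)

variable {Φ : AddMonoidAlgebra ℂ (Dual ℤ N) →ₐ[ℂ] K}

theorem character_zero : character Φ 0 = 1 := map_one Φ

theorem character_add (v w : Dual ℤ N) :
    character Φ (v + w) = character Φ v * character Φ w := by
  rw [character, character, character, ← map_mul, AddMonoidAlgebra.single_mul_single, one_mul]

theorem character_mul_neg (w : Dual ℤ N) : character Φ w * character Φ (-w) = 1 := by
  rw [← character_add, add_neg_cancel, character_zero]

theorem character_ne_zero (w : Dual ℤ N) : character Φ w ≠ 0 :=
  left_ne_zero_of_mul_eq_one (character_mul_neg w)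

theorem character_neg (w : Dual ℤ N) : character Φ (-w) = (character Φ w)⁻¹ :=
  eq_inv_of_mul_eq_one_right (character_mul_neg w)

theorem character_nsmul (k : ℕ) (w : Dual ℤ N) : character Φ (k • w) = character Φ w ^ k := by
  induction k with
  | zero => rw [zero_smul, character_zero, pow_zero]
  | succ k ih => rw [succ_nsmul, character_add, ih, pow_succ]

theorem character_sum {ι : Type*} (s : Finset ι) (w : ι → Dual ℤ N) :
    character Φ (∑ i ∈ s, w i) = ∏ i ∈ s, character Φ (w i) := by
  classical
  induction s using Finset.induction_on with
  | empty => simp [character_zero]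
  | insert i s hi ih => rw [Finset.sum_insert hi, Finset.prod_insert hi, character_add, ih]

theorem map_single_eq_smul_character (w : Dual ℤ N) (c : ℂ) :
    Φ (AddMonoidAlgebra.single w c) = c • character Φ w := by
  rw [character, ← map_smul, AddMonoidAlgebra.smul_single, smul_eq_mul, mul_one]

variable {ι : Type} [Fintype ι]

theorem sum_smul_coord (e : Basis ι ℤ N) (w : Dual ℤ N) : w = ∑ i, w (e i) • e.coord i := by
  refine e.ext fun j => ?_
  rw [LinearMap.sum_apply, Finset.sum_eq_single j]
  · simp
  · intro i _ hij
    simp [Finsupp.single_eq_of_ne hij]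
  · simp

/-- The differentials of the coordinate characters form a basis of the Kähler differentials of the
function field: `K` is the fraction field of the polynomial ring in these characters. -/
theorem IsTorusField.exists_basis_differentials (hΦ : IsTorusField Φ) (e : Basis ι ℤ N) :
    ∃ β : Basis ι K Ω[K⁄ℂ], ∀ i, β i = KaehlerDifferential.D ℂ K (character Φ (e.coord i)) := by
  classical
  let F : MvPolynomial ι ℂ →ₐ[ℂ] K := MvPolynomial.aeval fun i => character Φ (e.coord i)
  let _ : Algebra (MvPolynomial ι ℂ) K := F.toAlgebra
  have halg : ∀ x, algebraMap (MvPolynomial ι ℂ) K x = F x := fun _ => rfl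
  have : IsScalarTower ℂ (MvPolynomial ι ℂ) K :=
    IsScalarTower.of_algebraMap_eq' F.comp_algebraMap.symm
  let θ : (ι →₀ ℕ) →+ Dual ℤ N :=
    { toFun := fun d => ∑ i, d i • e.coord i
      map_zero' := by simp
      map_add' := fun a b => by simp [add_smul, Finset.sum_add_distrib] }
  have hθ : Function.Injective θ := by
    intro a b h
    ext j
    have := LinearMap.congr_fun (show ∑ i, a i • e.coord i = ∑ i, b i • e.coord i from h) (e j)
    simpa [LinearMap.sum_apply, Finsupp.single_apply] using this
  have hF : F = Φ.comp (AddMonoidAlgebra.mapDomainAlgHom ℂ ℂ θ) := by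
    refine MvPolynomial.algHom_ext fun i => ?_
    rw [MvPolynomial.aeval_X, AlgHom.comp_apply]
    change _ = Φ (AddMonoidAlgebra.mapDomain θ (AddMonoidAlgebra.single (Finsupp.single i 1) 1))
    rw [AddMonoidAlgebra.mapDomain_single, character]
    congr 2
    simp [θ, Finsupp.single_apply]
  have hinj : Function.Injective F := by
    rw [hF]
    exact hΦ.injective.comp (AddMonoidAlgebra.mapDomain_injective hθ)
  have hmem : ∀ z : K, z ∈ Subfield.closure (Set.range F) := by
    have hchar : ∀ w : Dual ℤ N, character Φ w ∈ Subfield.closure (Set.range F) := by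
      intro w
      have hx : ∀ i, character Φ (e.coord i) ∈ Subfield.closure (Set.range F) := fun i =>
        Subfield.subset_closure ⟨MvPolynomial.X i, MvPolynomial.aeval_X _ _⟩
      rw [sum_smul_coord e w, character_sum]
      refine prod_mem fun i _ => ?_
      rcases Int.eq_nat_or_neg (w (e i)) with ⟨k, h | h⟩
      · rw [h, natCast_zsmul, character_nsmul]
        exact pow_mem (hx i) k
      · rw [h, neg_smul, natCast_zsmul, character_neg, character_nsmul]
        exact inv_mem (pow_mem (hx i) k)
    have hΦmem : ∀ f, Φ f ∈ Subfield.closure (Set.range F) := by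
      intro f
      induction f using AddMonoidAlgebra.induction_linear with
      | zero => rw [map_zero]; exact zero_mem _
      | add f g hf hg => rw [map_add]; exact add_mem hf hg
      | single w c =>
        rw [map_single_eq_smul_character, Algebra.smul_def]
        exact mul_mem (Subfield.subset_closure ⟨algebraMap ℂ _ c, F.commutes c⟩) (hchar w)
    intro z
    obtain ⟨f, g, rfl⟩ := hΦ.exists_div z
    exact div_mem (hΦmem f) (hΦmem g)
  have : FaithfulSMul (MvPolynomial ι ℂ) K := (faithfulSMul_iff_algebraMap_injective _ _).2 hinj
  have : IsFractionRing (MvPolynomial ι ℂ) K := by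
    refine IsFractionRing.of_field _ _ fun z => ?_
    obtain ⟨y, hy, x, hx, rfl⟩ := Subfield.mem_closure_iff.1 (hmem z)
    have hr : Subring.closure (Set.range F) = F.toRingHom.range := by
      have : Set.range F = (F.toRingHom.range : Set K) := rfl
      rw [this, Subring.closure_eq]
    rw [hr] at hy hx
    obtain ⟨a, rfl⟩ := hy
    obtain ⟨b, rfl⟩ := hx
    exact ⟨a, b, rfl⟩
  refine ⟨(KaehlerDifferential.mvPolynomialBasis ℂ ι).ofIsLocalizedModule K
    (nonZeroDivisors (MvPolynomial ι ℂ))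
    (KaehlerDifferential.map ℂ ℂ (MvPolynomial ι ℂ) K), fun i => ?_⟩
  rw [Basis.ofIsLocalizedModule_apply, KaehlerDifferential.mvPolynomialBasis_apply,
    KaehlerDifferential.map_D]
  rw [halg, MvPolynomial.aeval_X]

/-- The logarithmic differential `dχ^w / χ^w`. -/
noncomputable def dlog (Φ : AddMonoidAlgebra ℂ (Dual ℤ N) →ₐ[ℂ] K) : Dual ℤ N →+ Ω[K⁄ℂ] where
  toFun w := (character Φ w)⁻¹ • KaehlerDifferential.D ℂ K (character Φ w)
  map_zero' := by simp [character_zero]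
  map_add' v w := by
    have hv := character_ne_zero (Φ := Φ) v
    have hw := character_ne_zero (Φ := Φ) w
    rw [character_add, Derivation.leibniz, smul_add, smul_smul, smul_smul, add_comm]
    congr 2 <;> field_simp

theorem dlog_apply (w : Dual ℤ N) :
    dlog Φ w = (character Φ w)⁻¹ • KaehlerDifferential.D ℂ K (character Φ w) := rfl

/-- A lattice basis, numbered by the index set that occurs in the definition of the rational top
forms, together with the basis of the differentials that it defines. -/
theorem IsTorusField.exists_equiv_basis (hΦ : IsTorusField Φ) (e : Basis ι ℤ N) :
    ∃ (ε : Fin (finrank K Ω[K⁄ℂ]) ≃ ι) (β : Basis (Fin (finrank K Ω[K⁄ℂ])) K Ω[K⁄ℂ]),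
      ∀ i, β i = KaehlerDifferential.D ℂ K (character Φ (e.coord (ε i))) := by
  obtain ⟨β, hβ⟩ := hΦ.exists_basis_differentials e
  let ε : Fin (finrank K Ω[K⁄ℂ]) ≃ ι := (Fintype.equivFinOfCardEq
    (finrank_eq_card_basis β).symm).symm
  exact ⟨ε, β.reindex ε.symm, fun i => by rw [Basis.reindex_apply, Equiv.symm_symm, hβ]⟩

/-- The wedge product of the logarithmic differentials of the dual basis. -/
noncomputable def logForm (Φ : AddMonoidAlgebra ℂ (Dual ℤ N) →ₐ[ℂ] K) (e : Basis ι ℤ N)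
    (ε : Fin (finrank K Ω[K⁄ℂ]) ≃ ι) : RationalTopForm ℂ K :=
  exteriorPower.ιMulti K _ fun i => dlog Φ (e.coord (ε i))

theorem ιMulti_D_eq_smul_logForm (e : Basis ι ℤ N) (ε : Fin (finrank K Ω[K⁄ℂ]) ≃ ι) :
    exteriorPower.ιMulti K _ (fun i => KaehlerDifferential.D ℂ K (character Φ (e.coord (ε i)))) =
      character Φ (∑ i, e.coord i) • logForm Φ e ε := by
  have : (fun i => KaehlerDifferential.D ℂ K (character Φ (e.coord (ε i)))) =
      fun i => character Φ (e.coord (ε i)) • dlog Φ (e.coord (ε i)) := by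
    funext i
    rw [dlog_apply, smul_inv_smul₀ (character_ne_zero _)]
  rw [this, AlternatingMap.map_smul_univ, character_sum,
    ε.prod_comp fun i => character Φ (e.coord i)]
  rfl

theorem IsTorusField.exists_dual_logForm_eq_one (hΦ : IsTorusField Φ) (e : Basis ι ℤ N)
    {ε : Fin (finrank K Ω[K⁄ℂ]) ≃ ι} :
    ∃ l : RationalTopForm ℂ K →ₗ[K] K, l (logForm Φ e ε) = 1 := by
  obtain ⟨β, hβ⟩ := hΦ.exists_basis_differentials e
  obtain ⟨l, hl⟩ := exists_dual_ιMulti_eq_one (β.reindex ε.symm)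
  refine ⟨character Φ (∑ i, e.coord i) • l, ?_⟩
  have : (⇑(β.reindex ε.symm) : _ → _) =
      fun i => KaehlerDifferential.D ℂ K (character Φ (e.coord (ε i))) := by
    funext i
    rw [Basis.reindex_apply, Equiv.symm_symm, hβ]
  rw [this, ιMulti_D_eq_smul_logForm, map_smul] at hl
  exact hl

/-- The logarithmic forms of two lattice bases differ by an integer (the determinant of the change
of basis), hence by a nonzero constant. -/
theorem IsTorusField.exists_logForm_eq_smul (hΦ : IsTorusField Φ) (e : Basis ι ℤ N)
    {ε : Fin (finrank K Ω[K⁄ℂ]) ≃ ι} {ι' : Type} [Fintype ι'] (e' : Basis ι' ℤ N)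
    {ε' : Fin (finrank K Ω[K⁄ℂ]) ≃ ι'} :
    ∃ c : ℂ, c ≠ 0 ∧ logForm Φ e' ε' = algebraMap ℂ K c • logForm Φ e ε := by
  obtain ⟨β, hβ⟩ := hΦ.exists_basis_differentials e
  let u : ι → Kˣ := fun i => Units.mk0 _ (inv_ne_zero (character_ne_zero (Φ := Φ) (e.coord i)))
  let γ : Basis (Fin (finrank K Ω[K⁄ℂ])) K Ω[K⁄ℂ] := (β.unitsSMul u).reindex ε.symm
  have hγ : ∀ i, γ i = dlog Φ (e.coord (ε i)) := by
    intro i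
    rw [Basis.reindex_apply, Equiv.symm_symm, Basis.unitsSMul_apply, hβ, dlog_apply]
    rfl
  let A : Matrix (Fin (finrank K Ω[K⁄ℂ])) (Fin (finrank K Ω[K⁄ℂ])) ℤ :=
    fun i j => e'.coord (ε' j) (e (ε i))
  have hA : γ.toMatrix (fun j => dlog Φ (e'.coord (ε' j))) = A.map (Int.castRingHom K) := by
    ext i j
    rw [Basis.toMatrix_apply]
    have : dlog Φ (e'.coord (ε' j)) = ∑ k, (Int.castRingHom K) (A k j) • γ k := by
      conv_lhs => rw [sum_smul_coord e (e'.coord (ε' j)), map_sum]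
      rw [← ε.sum_comp]
      refine Finset.sum_congr rfl fun k _ => ?_
      rw [map_zsmul, hγ, eq_intCast, Int.cast_smul_eq_zsmul]
    rw [this, γ.repr_sum_self]
    rfl
  have hdet : logForm Φ e' ε' = algebraMap ℂ K (A.det : ℂ) • logForm Φ e ε := by
    rw [logForm, ιMulti_eq_det_smul γ, Basis.det_apply, hA, ← RingHom.mapMatrix_apply,
      ← RingHom.map_det, eq_intCast, map_intCast, logForm]
    congr 2
    funext i
    exact hγ i
  refine ⟨A.det, fun h0 => ?_, hdet⟩
  obtain ⟨l, hl⟩ := hΦ.exists_dual_logForm_eq_one e' (ε := ε')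
  rw [hdet, h0, map_zero, zero_smul, map_zero] at hl
  exact zero_ne_one hl

end TorusField
end ToricFano

namespace ToricFano

open Module

/-! ### Regularity of pluri-anticanonical sections on a chart -/

section RegularForms

variable {k K : Type} [Field k] [Field K] [Algebra k K] {O : Subring K} {m : ℕ}

theorem isRegularAt_iff_of_span {ω : RationalTopForm k K}
    (hω : regularTopForms k O = Submodule.span O {ω}) (s : RationalAnticanonicalSection k K m) :
    IsRegularAt s O ↔ s (fun _ => ω) ∈ O := by
  constructor
  · exact fun h => h _ fun _ => hω ▸ Submodule.mem_span_singleton_self ω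
  · intro h η hη
    have : ∀ i, ∃ a : O, a • ω = η i := fun i =>
      Submodule.mem_span_singleton.1 (hω ▸ hη i)
    choose a ha using this
    have hη' : η = fun i => (a i : K) • ω := funext fun i => (ha i).symm
    rw [hη', MultilinearMap.map_smul_univ]
    exact mul_mem (prod_mem fun i _ => (a i).2) h

theorem isNonvanishingAt_iff_of_span {ω : RationalTopForm k K}
    (hω : regularTopForms k O = Submodule.span O {ω}) {s : RationalAnticanonicalSection k K m}
    (hs : s (fun _ => ω) ∈ O) :
    IsNonvanishingAt s O ↔ s (fun _ => ω) ≠ 0 ∧ (s fun _ => ω)⁻¹ ∈ O := by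
  constructor
  · rintro ⟨η, hη, u, hu⟩
    have : ∀ i, ∃ a : O, a • ω = η i := fun i =>
      Submodule.mem_span_singleton.1 (hω ▸ hη i)
    choose a ha using this
    have hη' : η = fun i => (a i : K) • ω := funext fun i => (ha i).symm
    rw [hη', MultilinearMap.map_smul_univ, smul_eq_mul] at hu
    have h1 : (s fun _ => ω) * ((∏ i, (a i : K)) * ((u⁻¹ : Oˣ) : O)) = 1 := by
      have : ((u : O) : K) * ((u⁻¹ : Oˣ) : O) = 1 := by
        exact_mod_cast congrArg Subtype.val u.mul_inv
      rw [← this, ← hu]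
      ring
    refine ⟨left_ne_zero_of_mul_eq_one h1, ?_⟩
    rw [inv_eq_of_mul_eq_one_right h1]
    exact mul_mem (prod_mem fun i _ => (a i).2) (SetLike.coe_mem _)
  · rintro ⟨h0, hinv⟩
    exact ⟨fun _ => ω, fun _ => hω ▸ Submodule.mem_span_singleton_self ω,
      ⟨⟨_, hs⟩, ⟨_, hinv⟩, Subtype.ext (mul_inv_cancel₀ h0), Subtype.ext (inv_mul_cancel₀ h0)⟩, rfl⟩

/-- The elements of a local ring whose differentials have regular coefficients. -/
def regularDifferentials {ι : Type} (β : Basis ι K Ω[K⁄k]) (O : Subring K) : Subring K where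
  carrier := {z | z ∈ O ∧ ∀ i, β.repr (KaehlerDifferential.D k K z) i ∈ O}
  zero_mem' := ⟨zero_mem O, fun i => by simp⟩
  one_mem' := ⟨one_mem O, fun i => by simp⟩
  add_mem' := fun ha hb => ⟨add_mem ha.1 hb.1, fun i => by
    rw [map_add, map_add, Finsupp.add_apply]
    exact add_mem (ha.2 i) (hb.2 i)⟩
  neg_mem' := fun ha => ⟨neg_mem ha.1, fun i => by
    rw [map_neg, map_neg, Finsupp.neg_apply]
    exact neg_mem (ha.2 i)⟩
  mul_mem' := fun {a b} ha hb => ⟨mul_mem ha.1 hb.1, fun i => by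
    rw [Derivation.leibniz, map_add, map_smul, map_smul, Finsupp.add_apply, Finsupp.smul_apply,
      Finsupp.smul_apply, smul_eq_mul, smul_eq_mul]
    exact add_mem (mul_mem ha.1 (hb.2 i)) (mul_mem hb.1 (ha.2 i))⟩

theorem inv_mem_regularDifferentials {ι : Type} {β : Basis ι K Ω[K⁄k]} {z : K}
    (hz : z ∈ regularDifferentials β O) (hinv : z⁻¹ ∈ O) : z⁻¹ ∈ regularDifferentials β O := by
  refine ⟨hinv, fun i => ?_⟩
  rw [Derivation.leibniz_inv, map_smul, Finsupp.smul_apply, smul_eq_mul]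
  exact mul_mem (neg_mem (pow_mem hinv 2)) (hz.2 i)

/-- If the functions `x₁, …, xₙ` of a local ring are such that `dx₁, …, dxₙ` is a basis of the
differentials, then the regular top forms are the multiples of `dx₁ ∧ ⋯ ∧ dxₙ`: the coefficient of
`df₁ ∧ ⋯ ∧ dfₙ` is a Jacobian determinant. -/
theorem regularTopForms_eq_span (β : Basis (Fin (finrank K Ω[K⁄k])) K Ω[K⁄k])
    {x : Fin (finrank K Ω[K⁄k]) → K} (hβ : ∀ i, β i = KaehlerDifferential.D k K (x i))
    (hx : ∀ i, x i ∈ O) (hO : O ≤ regularDifferentials β O) :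
    regularTopForms k O = Submodule.span O {exteriorPower.ιMulti K _
      fun i => KaehlerDifferential.D k K (x i)} := by
  apply le_antisymm
  · refine Submodule.span_le.2 ?_
    rintro _ ⟨f, hf, rfl⟩
    refine Submodule.mem_span_singleton.2
      ⟨⟨β.det fun i => KaehlerDifferential.D k K (f i), ?_⟩, ?_⟩
    · rw [Basis.det_apply, Matrix.det_apply]
      refine sum_mem fun σ _ => ?_
      rw [Units.smul_def]
      exact zsmul_mem (prod_mem fun i _ => (hO (hf i)).2 _) _
    · rw [ιMulti_eq_det_smul β fun i => KaehlerDifferential.D k K (f i)]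
      have : (β : _ → _) = fun i => KaehlerDifferential.D k K (x i) := funext hβ
      rw [← this]
      rfl
  · exact Submodule.span_mono (Set.singleton_subset_iff.2 ⟨x, hx, rfl⟩)

end RegularForms

section Charts

variable {N : Type} [AddCommGroup N] {K : Type} [Field K] [Algebra ℂ K]

/-- The coordinate ring of an affine toric variety as a subring of that of the torus. -/
noncomputable def chartToTorus (A : Finset N) : ChartRing A →+* AddMonoidAlgebra ℂ (Dual ℤ N) :=
  AddMonoidAlgebra.mapDomainRingHom ℂ (dualMonoid A).subtype

theorem chartToTorus_single {A : Finset N} (w : dualMonoid A) (c : ℂ) :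
    chartToTorus A (AddMonoidAlgebra.single w c) = AddMonoidAlgebra.single w.1 c := by
  simp [chartToTorus]

theorem chartToTorus_injective (A : Finset N) : Function.Injective (chartToTorus A) :=
  AddMonoidAlgebra.mapDomain_injective Subtype.val_injective

theorem chartToTorus_chartMap {A B : Finset N} (h : A ⊆ B) (a : ChartRing B) :
    chartToTorus A (chartMap h a) = chartToTorus B a := by
  induction a using AddMonoidAlgebra.induction_linear with
  | zero => simp
  | add a b ha hb => rw [map_add, map_add, map_add, ha, hb]
  | single w c => rw [chartMap_single, chartToTorus_single, chartToTorus_single]; rfl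

/-- `O` is the local ring of the affine toric variety of `A` at the point `p`. -/
def IsChartLocalRing (Φ : AddMonoidAlgebra ℂ (Dual ℤ N) →ₐ[ℂ] K) (A : Finset N)
    (p : PrimeSpectrum (ChartRing A)) (O : Subring K) : Prop :=
  ∀ z, z ∈ O ↔ ∃ a b, b ∉ p.asIdeal ∧ z * Φ (chartToTorus A b) = Φ (chartToTorus A a)

variable {Φ : AddMonoidAlgebra ℂ (Dual ℤ N) →ₐ[ℂ] K} {A : Finset N}
  {p : PrimeSpectrum (ChartRing A)} {O : Subring K}

theorem IsChartLocalRing.map_mem (hO : IsChartLocalRing Φ A p O) (a : ChartRing A) :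
    Φ (chartToTorus A a) ∈ O :=
  (hO _).2 ⟨a, 1, fun h => p.isPrime.ne_top ((Ideal.eq_top_iff_one _).2 h), by simp⟩

theorem IsChartLocalRing.algebraMap_mem (hO : IsChartLocalRing Φ A p O) (c : ℂ) :
    algebraMap ℂ K c ∈ O := by
  have := hO.map_mem (AddMonoidAlgebra.single 0 c)
  rwa [chartToTorus_single, map_single_eq_smul_character, ZeroMemClass.coe_zero,
    character_zero, Algebra.smul_def, mul_one] at this

theorem IsChartLocalRing.character_mem (hO : IsChartLocalRing Φ A p O) {w : Dual ℤ N}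
    (hw : w ∈ dualMonoid A) : character Φ w ∈ O := by
  have := hO.map_mem (AddMonoidAlgebra.single ⟨w, hw⟩ 1)
  rwa [chartToTorus_single] at this

theorem coord_mem_dualMonoid {e : Basis A ℤ N} (he : ∀ v, e v = v) (i : A) :
    e.coord i ∈ dualMonoid A := by
  classical
  intro v hv
  have := e.coord_apply i (e ⟨v, hv⟩)
  rw [he] at this
  rw [this, ← he ⟨v, hv⟩, e.repr_self, Finsupp.single_apply]
  split_ifs <;> simp

theorem IsTorusField.map_chart_ne_zero (hΦ : IsTorusField Φ) {b : ChartRing A} (hb : b ≠ 0) :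
    Φ (chartToTorus A b) ≠ 0 := fun h => hb <| by
  rw [← map_zero Φ] at h
  have := hΦ.injective h
  rw [← map_zero (chartToTorus A)] at this
  exact chartToTorus_injective A this

theorem ne_zero_of_notMem {b : ChartRing A} (hb : b ∉ p.asIdeal) : b ≠ 0 :=
  fun h => hb (h ▸ zero_mem _)

theorem IsChartLocalRing.inv_mem_iff (hΦ : IsTorusField Φ) (hO : IsChartLocalRing Φ A p O)
    {a : ChartRing A} (ha : a ≠ 0) : (Φ (chartToTorus A a))⁻¹ ∈ O ↔ a ∉ p.asIdeal := by
  constructor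
  · intro h hap
    obtain ⟨c, b, hb, hcb⟩ := (hO _).1 h
    have h0 := hΦ.map_chart_ne_zero ha
    have : Φ (chartToTorus A b) = Φ (chartToTorus A (c * a)) := by
      rw [map_mul, map_mul, ← hcb]
      field_simp
    have := chartToTorus_injective A (hΦ.injective this)
    exact hb (this ▸ Ideal.mul_mem_left _ _ hap)
  · intro h
    exact (hO _).2 ⟨1, a, h, by rw [inv_mul_cancel₀ (hΦ.map_chart_ne_zero ha), map_one, map_one]⟩

/-- The differentials of the regular functions on the chart of a maximal cone have regular
coefficients in the basis given by its coordinate characters. -/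
theorem IsChartLocalRing.le_regularDifferentials (hΦ : IsTorusField Φ)
    (hO : IsChartLocalRing Φ A p O) (e : Basis A ℤ N) (he : ∀ v, e v = v) {ι : Type} (ε : ι → A)
    (β : Basis ι K Ω[K⁄ℂ])
    (hβ : ∀ i, β i = KaehlerDifferential.D ℂ K (character Φ (e.coord (ε i))))
    (hε : Function.Surjective ε) : O ≤ regularDifferentials β O := by
  classical
  have hx : ∀ i, character Φ (e.coord i) ∈ regularDifferentials β O := by
    intro i
    refine ⟨hO.character_mem (coord_mem_dualMonoid he i), fun j => ?_⟩
    obtain ⟨i, rfl⟩ := hε i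
    rw [← hβ, β.repr_self, Finsupp.single_apply]
    split_ifs
    · exact one_mem O
    · exact zero_mem O
  have hmap : ∀ a, Φ (chartToTorus A a) ∈ regularDifferentials β O := by
    intro a
    induction a using AddMonoidAlgebra.induction_linear with
    | zero => rw [map_zero, map_zero]; exact zero_mem _
    | add a b ha hb => rw [map_add, map_add]; exact add_mem ha hb
    | single w c =>
      rw [chartToTorus_single, map_single_eq_smul_character, Algebra.smul_def]
      refine mul_mem ⟨hO.algebraMap_mem c, fun j => by simp⟩ ?_
      rw [sum_smul_coord e w.1, character_sum]
      refine prod_mem fun i _ => ?_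
      have hn : 0 ≤ w.1 (e i) := by rw [he]; exact w.2 _ i.2
      obtain ⟨n, hn⟩ := Int.eq_ofNat_of_zero_le hn
      rw [hn, natCast_zsmul, character_nsmul]
      exact pow_mem (hx i) n
  intro z hz
  obtain ⟨a, b, hb, hab⟩ := (hO z).1 hz
  have hb0 := ne_zero_of_notMem hb
  rw [← mul_inv_eq_iff_eq_mul₀ (hΦ.map_chart_ne_zero hb0) |>.2 hab.symm]
  exact mul_mem (hmap a) (inv_mem_regularDifferentials (hmap b) ((hO.inv_mem_iff hΦ hb0).2 hb))

variable {m : ℕ}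

/-- On the chart of a maximal cone the regular top forms are generated by the logarithmic form times
the character `χ^u`, where `u` is `1` on the generators of the cone. -/
theorem IsChartLocalRing.exists_span (hΦ : IsTorusField Φ)
    (hO : IsChartLocalRing Φ A p O) (e : Basis A ℤ N) (he : ∀ v, e v = v) {u : Dual ℤ N}
    (hu : ∀ v ∈ A, u v = 1) {ι : Type} [Fintype ι] (e₀ : Basis ι ℤ N)
    (ε₀ : Fin (finrank K Ω[K⁄ℂ]) ≃ ι) :
    ∃ c : ℂ, c ≠ 0 ∧ regularTopForms ℂ O =
      Submodule.span O {(algebraMap ℂ K c * character Φ u) • logForm Φ e₀ ε₀} := by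
  classical
  obtain ⟨ε, β, hβ⟩ := hΦ.exists_equiv_basis e
  obtain ⟨c, hc, hlog⟩ := hΦ.exists_logForm_eq_smul e₀ (ε := ε₀) e (ε' := ε)
  have hle := hO.le_regularDifferentials hΦ e he ε β hβ ε.surjective
  have hu' : ∑ i, e.coord i = u := by
    refine e.ext fun i => ?_
    rw [LinearMap.sum_apply, Finset.sum_eq_single i]
    · rw [e.coord_apply, e.repr_self, Finsupp.single_eq_same, he, hu _ i.2]
    · intro j _ hji
      rw [e.coord_apply, e.repr_self, Finsupp.single_eq_of_ne hji]
    · simp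
  refine ⟨c, hc, ?_⟩
  rw [regularTopForms_eq_span β hβ (fun i => hO.character_mem (coord_mem_dualMonoid he _)) hle,
    ιMulti_D_eq_smul_logForm, hlog, hu', smul_smul, mul_comm]

/-- On the chart of a maximal cone, the value of a section at the logarithmic form, times `χ^(m u)`,
is its local equation: it decides both regularity and nonvanishing. -/
theorem IsChartLocalRing.isRegularAt_and_isNonvanishingAt_iff (hΦ : IsTorusField Φ)
    (hO : IsChartLocalRing Φ A p O) (e : Basis A ℤ N) (he : ∀ v, e v = v) {u : Dual ℤ N}
    (hu : ∀ v ∈ A, u v = 1) {ι : Type} [Fintype ι] (e₀ : Basis ι ℤ N)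
    (ε₀ : Fin (finrank K Ω[K⁄ℂ]) ≃ ι) (s : RationalAnticanonicalSection ℂ K m) :
    (IsRegularAt s O ↔ character Φ (m • u) * s (fun _ => logForm Φ e₀ ε₀) ∈ O) ∧
    (IsRegularAt s O → (IsNonvanishingAt s O ↔
      character Φ (m • u) * s (fun _ => logForm Φ e₀ ε₀) ≠ 0 ∧
        (character Φ (m • u) * s (fun _ => logForm Φ e₀ ε₀))⁻¹ ∈ O)) := by
  obtain ⟨c, hc, hspan⟩ := hO.exists_span hΦ e he hu e₀ ε₀
  have hval : s (fun _ => (algebraMap ℂ K c * character Φ u) • logForm Φ e₀ ε₀) =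
      algebraMap ℂ K (c ^ m) * (character Φ (m • u) * s (fun _ => logForm Φ e₀ ε₀)) := by
    rw [MultilinearMap.map_smul_univ, Finset.prod_const, Finset.card_univ, Fintype.card_fin,
      mul_pow, smul_eq_mul, character_nsmul, map_pow, mul_assoc]
  have hcm : algebraMap ℂ K (c ^ m) ≠ 0 := by
    rw [map_pow]
    exact pow_ne_zero _ ((map_ne_zero _).2 hc)
  have hcO := hO.algebraMap_mem (c ^ m)
  have hcO' : (algebraMap ℂ K (c ^ m))⁻¹ ∈ O := by
    rw [← map_inv₀]
    exact hO.algebraMap_mem _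
  have hmem : ∀ z, algebraMap ℂ K (c ^ m) * z ∈ O ↔ z ∈ O := fun z =>
    ⟨fun h => by
      have := mul_mem hcO' h
      rwa [inv_mul_cancel_left₀ hcm] at this, fun h => mul_mem hcO h⟩
  have hmem' : ∀ z, (algebraMap ℂ K (c ^ m))⁻¹ * z ∈ O ↔ z ∈ O := fun z =>
    ⟨fun h => by
      have := mul_mem hcO h
      rwa [mul_inv_cancel_left₀ hcm] at this, fun h => mul_mem hcO' h⟩
  have h1 := isRegularAt_iff_of_span hspan s
  refine ⟨by rw [h1, hval, hmem], fun hreg => ?_⟩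
  rw [isNonvanishingAt_iff_of_span hspan (h1.1 hreg), hval, mul_ne_zero_iff, mul_inv, hmem']
  exact ⟨fun h => ⟨h.1.2, h.2⟩, fun h => ⟨⟨hcm, h.1⟩, h.2⟩⟩

end Charts
end ToricFano

namespace ToricFano

open Module

/-! ### The points of a chart that correspond to faces -/

/-- An element of the fraction field that is regular on the basic open set of `f` becomes an element
of the ring after multiplication by a power of `f`. -/
theorem exists_pow_mul_eq_map {R K : Type*} [CommRing R] [Field K] (φ : R →+* K) {h : K} {f : R}
    (hf : ∀ p : PrimeSpectrum R, f ∉ p.asIdeal → ∃ a b, b ∉ p.asIdeal ∧ h * φ b = φ a) :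
    ∃ k : ℕ, ∃ a, φ f ^ k * h = φ a := by
  let I : Ideal R :=
    { carrier := {b | ∃ a, h * φ b = φ a}
      zero_mem' := ⟨0, by simp⟩
      add_mem' := by
        rintro b c ⟨a, ha⟩ ⟨d, hd⟩
        exact ⟨a + d, by rw [map_add, mul_add, ha, hd, map_add]⟩
      smul_mem' := by
        rintro r b ⟨a, ha⟩
        exact ⟨r * a, by rw [smul_eq_mul, map_mul, map_mul, ← ha]; ring⟩ }
  have hmem : f ∈ I.radical := by
    rw [Ideal.radical_eq_sInf, Ideal.mem_sInf]
    rintro J ⟨hIJ, hJ⟩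
    by_contra hfJ
    obtain ⟨a, b, hb, hab⟩ := hf ⟨J, hJ⟩ hfJ
    exact hb (hIJ ⟨a, hab⟩)
  obtain ⟨k, a, ha⟩ := hmem
  exact ⟨k, a, by rw [← ha, map_pow, mul_comm]⟩

section Face

variable {N : Type} [AddCommGroup N]

theorem mem_dualMonoid_of_coeff_ne_zero {A : Finset N} {f : ChartRing A} {v : Dual ℤ N}
    (h : (chartToTorus A f).coeff v ≠ 0) : v ∈ dualMonoid A := by
  classical
  by_contra hv
  refine h ?_
  clear h
  induction f using AddMonoidAlgebra.induction_linear with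
  | zero => simp
  | add a b ha hb => rw [map_add, AddMonoidAlgebra.coeff_add, Finsupp.add_apply, ha, hb, add_zero]
  | single w c =>
    rw [chartToTorus_single, AddMonoidAlgebra.coeff_single, Finsupp.single_apply, if_neg]
    rintro rfl
    exact hv w.2

open Classical in
/-- Restriction of functions to the torus orbit of a face `C` of the cone `A`, as an endomorphism
of the torus coordinate ring: the characters that do not vanish on `C` are mapped to zero. -/
noncomputable def restrictToFace {C A : Finset N} (h : C ⊆ A) :
    ChartRing A →ₐ[ℂ] AddMonoidAlgebra ℂ (Dual ℤ N) :=
  AddMonoidAlgebra.lift ℂ _ (dualMonoid A)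
    { toFun := fun w => if ∀ ρ ∈ C, w.toAdd.1 ρ = 0 then AddMonoidAlgebra.single w.toAdd.1 1 else 0
      map_one' := by
        rw [if_pos]
        · rfl
        · intro ρ _
          rfl
      map_mul' := fun v w => by
        have key : (∀ ρ ∈ C, (v * w).toAdd.1 ρ = 0) ↔
            (∀ ρ ∈ C, v.toAdd.1 ρ = 0) ∧ ∀ ρ ∈ C, w.toAdd.1 ρ = 0 := by
          rw [← forall₂_and]
          refine forall₂_congr fun ρ hρ => ?_
          have h1 := v.toAdd.2 ρ (h hρ)
          have h2 := w.toAdd.2 ρ (h hρ)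
          change v.toAdd.1 ρ + w.toAdd.1 ρ = 0 ↔ _
          omega
        by_cases hv : ∀ ρ ∈ C, v.toAdd.1 ρ = 0
        · by_cases hw : ∀ ρ ∈ C, w.toAdd.1 ρ = 0
          · rw [if_pos (key.2 ⟨hv, hw⟩), if_pos hv, if_pos hw,
              AddMonoidAlgebra.single_mul_single, one_mul]
            rfl
          · rw [if_neg fun h => hw (key.1 h).2, if_neg hw, mul_zero]
        · rw [if_neg fun h => hv (key.1 h).1, if_neg hv, zero_mul] }

open Classical in
theorem coeff_restrictToFace {C A : Finset N} (h : C ⊆ A) (f : ChartRing A) (v : Dual ℤ N) :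
    (restrictToFace h f).coeff v = if ∀ ρ ∈ C, v ρ = 0 then (chartToTorus A f).coeff v else 0 := by
  induction f using AddMonoidAlgebra.induction_linear with
  | zero => simp
  | add a b ha hb =>
    rw [map_add, map_add, AddMonoidAlgebra.coeff_add, AddMonoidAlgebra.coeff_add,
      Finsupp.add_apply, Finsupp.add_apply, ha, hb]
    split_ifs <;> simp
  | single w c =>
    rw [restrictToFace, AddMonoidAlgebra.lift_single, chartToTorus_single]
    simp only [MonoidHom.coe_mk, OneHom.coe_mk, toAdd_ofAdd]
    by_cases hvw : w.1 = v
    · subst hvw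
      split_ifs <;> simp
    · split_ifs <;> simp [hvw]

variable [Module.Free ℤ N] [Module.Finite ℤ N]

theorem isDomain_torusRing (N : Type) [AddCommGroup N] [Module.Free ℤ N] [Module.Finite ℤ N] :
    IsDomain (AddMonoidAlgebra ℂ (Dual ℤ N)) := by
  let b := Module.Free.chooseBasis ℤ N
  let f : Dual ℤ N →ₙ+ (Free.ChooseBasisIndex ℤ N → ℤ) :=
    { toFun := fun w i => w (b i), map_add' := fun _ _ => rfl }
  have : UniqueSums (Dual ℤ N) :=
    UniqueSums.of_injective_addHom f (fun v w h => b.ext fun i => congrFun h i) inferInstance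
  have : NoZeroDivisors (AddMonoidAlgebra ℂ (Dual ℤ N)) := inferInstance
  exact NoZeroDivisors.to_isDomain _

/-- The generic point of the torus orbit of a face `C` of the cone `A`. -/
noncomputable def facePoint {C A : Finset N} (h : C ⊆ A) : PrimeSpectrum (ChartRing A) :=
  ⟨RingHom.ker (restrictToFace h).toRingHom,
    have := isDomain_torusRing N; RingHom.ker_isPrime _⟩

theorem notMem_facePoint_iff {C A : Finset N} (h : C ⊆ A) {f : ChartRing A} :
    f ∉ (facePoint h).asIdeal ↔ ∃ v, (∀ ρ ∈ C, v ρ = 0) ∧ (chartToTorus A f).coeff v ≠ 0 := by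
  classical
  change ¬ restrictToFace h f = 0 ↔ _
  constructor
  · intro hf
    by_contra! hcon
    refine hf (AddMonoidAlgebra.coeff_injective (Finsupp.ext fun v => ?_))
    rw [coeff_restrictToFace]
    split_ifs with hv
    · exact hcon v hv
    · rfl
  · rintro ⟨v, hv, hfv⟩ h0
    have := coeff_restrictToFace h f v
    rw [if_pos hv, h0] at this
    exact hfv this.symm

variable {K : Type} [Field K] [Algebra ℂ K] {Φ : AddMonoidAlgebra ℂ (Dual ℤ N) →ₐ[ℂ] K}

/-- If the local equation `z χ^(l u_A)` of a section does not vanish at the fixed point of the cone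
`A`, then the character `χ^(-l u_A)` occurs in `z`, hence `χ^(l (u_B - u_A))` occurs in the local
equation on the chart of `B`. -/
theorem IsTorusField.coeff_ne_zero_of_notMem (hΦ : IsTorusField Φ) {A B : Finset N}
    (hA : ∀ w : Dual ℤ N, (∀ ρ ∈ A, w ρ = 0) → w = 0) {uA uB : Dual ℤ N} {l : ℕ} {z : K}
    {a : ChartRing A} {b : ChartRing B} (ha : Φ (chartToTorus A a) = character Φ (l • uA) * z)
    (hb : Φ (chartToTorus B b) = character Φ (l • uB) * z)
    (h : a ∉ (facePoint (Finset.Subset.refl A)).asIdeal) :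
    (chartToTorus B b).coeff (l • (uB - uA)) ≠ 0 := by
  obtain ⟨v, hv, hav⟩ := (notMem_facePoint_iff _).1 h
  obtain rfl := hA v hv
  have hab : chartToTorus B b = AddMonoidAlgebra.single (l • (uB - uA)) 1 * chartToTorus A a := by
    apply hΦ.injective
    rw [map_mul, ha, hb]
    change _ = character Φ (l • (uB - uA)) * _
    rw [← mul_assoc, ← character_add, ← smul_add, sub_add_cancel]
  rw [hab]
  have := AddMonoidAlgebra.coeff_single_mul_add (chartToTorus A a) (1 : ℂ) (l • (uB - uA)) 0
  rw [add_zero, one_mul] at this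
  rwa [this]

/-- A character with a pole along the divisor of the ray `ρ` is not regular at its generic point. -/
theorem IsChartLocalRing.character_notMem (hΦ : IsTorusField Φ) {B : Finset N} {ρ : N}
    (hρ : {ρ} ⊆ B) {O : Subring K} (hO : IsChartLocalRing Φ B (facePoint hρ) O) {w : Dual ℤ N}
    (hw : w ρ < 0) : character Φ w ∉ O := by
  intro hmem
  obtain ⟨a, b, hb, hab⟩ := (hO _).1 hmem
  obtain ⟨v, hv, hbv⟩ := (notMem_facePoint_iff hρ).1 hb
  rw [character, ← map_mul] at hab
  have hab := hΦ.injective hab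
  have : (chartToTorus B a).coeff (w + v) ≠ 0 := by
    rwa [← hab, AddMonoidAlgebra.coeff_single_mul_add, one_mul]
  have h1 := mem_dualMonoid_of_coeff_ne_zero this ρ (hρ (Finset.mem_singleton_self ρ))
  have h2 := hv ρ (Finset.mem_singleton_self ρ)
  rw [LinearMap.add_apply] at h1
  omega

end Face
end ToricFano

namespace ToricFano

open CategoryTheory CategoryTheory.Limits AlgebraicGeometry

/-! ### Affine charts and the function field -/

section Scheme

variable {X : Scheme.{0}} [IsIntegral X]

/-- The local ring at a point of an affine open set consists of the fractions of regular functions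
whose denominator is invertible at the point. -/
theorem mem_localSubring_iff {U : X.Opens} (hU : IsAffineOpen U) {x : X} (hx : x ∈ U)
    [Nonempty U] (z : X.functionField) :
    z ∈ localSubring X x ↔ ∃ a b : Γ(X, U), x ∈ X.basicOpen b ∧
      z * X.germToFunctionField U b = X.germToFunctionField U a := by
  have hloc := hU.isLocalization_stalk ⟨x, hx⟩
  let _ : Algebra Γ(X, U) (X.presheaf.stalk x) :=
    TopCat.Presheaf.algebra_section_stalk X.presheaf ⟨x, hx⟩
  have halg : ∀ a : Γ(X, U), algebraMap Γ(X, U) (X.presheaf.stalk x) a = X.presheaf.germ U x hx a :=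
    fun _ => rfl
  constructor
  · rintro ⟨y, rfl⟩
    obtain ⟨⟨a, b⟩, hab⟩ := IsLocalization.surj (hU.primeIdealOf ⟨x, hx⟩).asIdeal.primeCompl y
    refine ⟨a, b.1, ?_, ?_⟩
    · rw [Scheme.mem_basicOpen _ _ _ hx]
      exact IsLocalization.map_units _ b
    · have := congrArg (algebraMap (X.presheaf.stalk x) X.functionField) hab
      rwa [map_mul, halg, halg, Scheme.algebraMap_germ_eq_germToFunctionField,
        Scheme.algebraMap_germ_eq_germToFunctionField] at this
  · rintro ⟨a, b, hb, hab⟩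
    rw [Scheme.mem_basicOpen _ _ _ hx] at hb
    obtain ⟨u, hu⟩ := hb
    refine ⟨X.presheaf.germ U x hx a * (u⁻¹ : (X.presheaf.stalk x)ˣ), ?_⟩
    have hu0 : algebraMap (X.presheaf.stalk x) X.functionField u ≠ 0 := (u.isUnit.map _).ne_zero
    apply mul_right_cancel₀ hu0
    rw [← map_mul, mul_assoc, Units.inv_mul, mul_one, hu,
      Scheme.algebraMap_germ_eq_germToFunctionField, Scheme.algebraMap_germ_eq_germToFunctionField,
      hab]

theorem germToFunctionField_mem_localSubring {U : X.Opens} {x : X} (hx : x ∈ U) [Nonempty U]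
    (a : Γ(X, U)) : X.germToFunctionField U a ∈ localSubring X x :=
  ⟨X.presheaf.germ U x hx a, Scheme.algebraMap_germ_eq_germToFunctionField _ _ _⟩

/-- An element of the local ring at a point of an affine open set is a fraction of functions that
are regular on the open set, with denominator invertible at the point. -/
theorem exists_regular_fraction {U : X.Opens} (hU : IsAffineOpen U) {x : X} (hx : x ∈ U)
    {z : X.functionField} (hz : z ∈ localSubring X x) :
    ∃ a b : X.functionField, (∀ y ∈ U, a ∈ localSubring X y) ∧ (∀ y ∈ U, b ∈ localSubring X y) ∧
      b ≠ 0 ∧ b⁻¹ ∈ localSubring X x ∧ z = a * b⁻¹ := by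
  have : Nonempty U := ⟨⟨x, hx⟩⟩
  obtain ⟨a, b, hb, hab⟩ := (mem_localSubring_iff hU hx z).1 hz
  have hbu : X.germToFunctionField U b ≠ 0 := by
    rw [Scheme.mem_basicOpen _ _ _ hx] at hb
    have := (hb.map (algebraMap (X.presheaf.stalk x) X.functionField)).ne_zero
    rwa [Scheme.algebraMap_germ_eq_germToFunctionField] at this
  refine ⟨_, _, fun y hy => germToFunctionField_mem_localSubring hy a,
    fun y hy => germToFunctionField_mem_localSubring hy b, hbu, ?_, ?_⟩
  · exact (mem_localSubring_iff hU hx _).2 ⟨1, b, hb, by rw [inv_mul_cancel₀ hbu, map_one]⟩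
  · rw [← hab, mul_inv_cancel_right₀ hbu]

variable {R : CommRingCat.{0}} [Nontrivial R] (f : Spec R ⟶ X) [IsOpenImmersion f]

instance nonempty_image_top : Nonempty (f ''ᵁ ⊤ : X.Opens) := by
  obtain ⟨p⟩ : Nonempty (PrimeSpectrum R) := inferInstance
  exact ⟨⟨f p, ⟨p, trivial, rfl⟩⟩⟩

/-- The inclusion of the coordinate ring of an affine chart in the function field. -/
noncomputable def chartToFunctionField : R →+* X.functionField :=
  ((Scheme.ΓSpecIso R).inv ≫ (f.appIso ⊤).inv ≫ X.germToFunctionField (f ''ᵁ ⊤)).hom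

theorem chartToFunctionField_apply (a : R) : chartToFunctionField f a =
    X.germToFunctionField (f ''ᵁ ⊤) ((f.appIso ⊤).inv ((Scheme.ΓSpecIso R).inv a)) := rfl

theorem chartToFunctionField_injective : Function.Injective (chartToFunctionField f) := by
  intro a b h
  have h := Scheme.germToFunctionField_injective X (f ''ᵁ ⊤) h
  have h := (ConcreteCategory.bijective_of_isIso (f.appIso ⊤).inv).1 h
  exact (ConcreteCategory.bijective_of_isIso (Scheme.ΓSpecIso R).inv).1 h

/-- A function on an open set containing the chart is determined by its restriction to the chart. -/
theorem chartToFunctionField_appLE (V : X.Opens) [Nonempty V] (hV : (⊤ : (Spec R).Opens) ≤ f ⁻¹ᵁ V)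
    (s : Γ(X, V)) :
    chartToFunctionField f ((Scheme.ΓSpecIso R).hom (f.appLE V ⊤ hV s)) =
      X.germToFunctionField V s := by
  have hle : f ''ᵁ ⊤ ≤ V := by
    rintro _ ⟨p, -, rfl⟩
    exact hV (show p ∈ ⊤ from trivial)
  have h1 : f.appLE V ⊤ hV = X.presheaf.map (homOfLE hle).op ≫ (f.appIso ⊤).hom := by
    rw [Scheme.Hom.appIso_hom', Scheme.Hom.map_appLE]
  rw [chartToFunctionField_apply, h1]
  simp only [CommRingCat.comp_apply, Iso.hom_inv_id_apply]
  exact X.presheaf.germ_res_apply (homOfLE hle) _ _ s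

theorem mem_localSubring_chart_iff (p : Spec R) (z : X.functionField) :
    z ∈ localSubring X (f p) ↔ ∃ a b : R, b ∉ (show PrimeSpectrum R from p).asIdeal ∧
      z * chartToFunctionField f b = chartToFunctionField f a := by
  have hU : IsAffineOpen (f ''ᵁ ⊤) := (isAffineOpen_top (Spec R)).image_of_isOpenImmersion f
  have hx : f p ∈ f ''ᵁ ⊤ := ⟨p, trivial, rfl⟩
  have hbasic : ∀ b : R, f p ∈ X.basicOpen ((f.appIso ⊤).inv ((Scheme.ΓSpecIso R).inv b)) ↔
      b ∉ (show PrimeSpectrum R from p).asIdeal := by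
    intro b
    have h2 : p ∈ f ⁻¹ᵁ X.basicOpen ((f.appIso ⊤).inv ((Scheme.ΓSpecIso R).inv b)) ↔
      b ∉ (show PrimeSpectrum R from p).asIdeal := by
      rw [Scheme.Hom.preimage_basicOpen, ← CommRingCat.comp_apply, Scheme.Hom.appIso_inv_app,
        Scheme.basicOpen_res_eq, basicOpen_eq_of_affine]
      rfl
    exact h2
  rw [mem_localSubring_iff hU hx]
  constructor
  · rintro ⟨a, b, hb, hab⟩
    obtain ⟨a, rfl⟩ := (ConcreteCategory.bijective_of_isIso (f.appIso ⊤).inv).2 a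
    obtain ⟨a, rfl⟩ := (ConcreteCategory.bijective_of_isIso (Scheme.ΓSpecIso R).inv).2 a
    obtain ⟨b, rfl⟩ := (ConcreteCategory.bijective_of_isIso (f.appIso ⊤).inv).2 b
    obtain ⟨b, rfl⟩ := (ConcreteCategory.bijective_of_isIso (Scheme.ΓSpecIso R).inv).2 b
    exact ⟨a, b, (hbasic b).1 hb, hab⟩
  · rintro ⟨a, b, hb, hab⟩
    exact ⟨_, _, (hbasic b).2 hb, hab⟩

theorem exists_chartToFunctionField_div (z : X.functionField) :
    ∃ a b : R, z = chartToFunctionField f a / chartToFunctionField f b := by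
  have := functionField_isFractionRing_of_isAffineOpen X (f ''ᵁ ⊤)
    ((isAffineOpen_top (Spec R)).image_of_isOpenImmersion f)
  obtain ⟨a, b, -, rfl⟩ := IsFractionRing.div_surjective (A := Γ(X, f ''ᵁ ⊤)) z
  obtain ⟨a, rfl⟩ := (ConcreteCategory.bijective_of_isIso (f.appIso ⊤).inv).2 a
  obtain ⟨a, rfl⟩ := (ConcreteCategory.bijective_of_isIso (Scheme.ΓSpecIso R).inv).2 a
  obtain ⟨b, rfl⟩ := (ConcreteCategory.bijective_of_isIso (f.appIso ⊤).inv).2 b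
  obtain ⟨b, rfl⟩ := (ConcreteCategory.bijective_of_isIso (Scheme.ΓSpecIso R).inv).2 b
  exact ⟨a, b, rfl⟩

/-- The inclusions of two charts in the function field are compatible with the map between them. -/
theorem chartToFunctionField_comp {S : CommRingCat.{0}} [Nontrivial S] (ψ : R ⟶ S)
    [IsOpenImmersion (Spec.map ψ ≫ f)] (a : R) :
    chartToFunctionField (Spec.map ψ ≫ f) (ψ a) = chartToFunctionField f a := by
  have hV : (⊤ : (Spec S).Opens) ≤ (Spec.map ψ ≫ f) ⁻¹ᵁ (f ''ᵁ ⊤) := fun p _ => ⟨_, trivial, rfl⟩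
  rw [chartToFunctionField_apply f, ← chartToFunctionField_appLE (Spec.map ψ ≫ f) _ hV]
  congr 1
  have h1 : (Spec.map ψ ≫ f).appLE (f ''ᵁ ⊤) ⊤ hV = (f.appIso ⊤).hom ≫ (Spec.map ψ).appTop := by
    have hT' : (⊤ : (Spec S).Opens) ≤ Spec.map ψ ⁻¹ᵁ ⊤ := fun _ _ => trivial
    have hT : (Spec.map ψ).appTop = (Spec.map ψ).appLE ⊤ ⊤ hT' :=
      (Scheme.Hom.appLE_eq_app (Spec.map ψ)).symm
    rw [hT, Scheme.Hom.appIso_hom', Scheme.Hom.appLE_comp_appLE]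
  have h2 : (Scheme.ΓSpecIso R).inv ≫ (f.appIso ⊤).inv ≫ (Spec.map ψ ≫ f).appLE (f ''ᵁ ⊤) ⊤ hV ≫
      (Scheme.ΓSpecIso S).hom = ψ := by
    rw [h1, Category.assoc, Iso.inv_hom_id_assoc, ← Scheme.ΓSpecIso_inv_naturality_assoc,
      Iso.inv_hom_id, Category.comp_id]
  exact (congrArg (fun φ : R ⟶ S => φ a) h2).symm

theorem structureMapFunctionField_eq (g : X ⟶ Spec (.of ℂ)) (ψ : CommRingCat.of ℂ ⟶ R)
    (h : f ≫ g = Spec.map ψ) (c : ℂ) :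
    chartToFunctionField f (ψ c) = structureMapFunctionField g c := by
  have hV : (⊤ : (Spec R).Opens) ≤ f ⁻¹ᵁ ⊤ := le_rfl
  have h2 : (Scheme.ΓSpecIso (.of ℂ)).inv ≫ g.appTop ≫ f.appLE ⊤ ⊤ hV ≫ (Scheme.ΓSpecIso R).hom =
      ψ := by
    have h1 : g.appTop ≫ f.appLE ⊤ ⊤ hV = (Spec.map ψ).appTop := by
      rw [← h, Scheme.Hom.comp_appTop]
      congr 1
    rw [reassoc_of% h1, ← Scheme.ΓSpecIso_inv_naturality_assoc, Iso.inv_hom_id, Category.comp_id]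
  have : Nonempty (⊤ : X.Opens) := ⟨⟨genericPoint X, trivial⟩⟩
  have h3 : ψ c = (Scheme.ΓSpecIso R).hom (f.appLE ⊤ ⊤ hV
      (g.appTop ((Scheme.ΓSpecIso (.of ℂ)).inv c))) :=
    (congrArg (fun φ : CommRingCat.of ℂ ⟶ R => φ c) h2).symm
  rw [h3, chartToFunctionField_appLE]
  rfl

end Scheme
end ToricFano

namespace ToricFano

open CategoryTheory CategoryTheory.Limits AlgebraicGeometry Module

/-! ### The toric variety and its affine charts -/

namespace NonsingularFan

variable {N : Type} [AddCommGroup N] (Δ : NonsingularFan N)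

/-- The affine chart of a cone. -/
noncomputable def chartι (A : Δ.cones) : Spec (.of (ChartRing A.1)) ⟶ Δ.toricVariety :=
  colimit.ι Δ.diagram A

instance (A : Δ.cones) : IsOpenImmersion (Δ.chartι A) :=
  inferInstanceAs (IsOpenImmersion (colimit.ι Δ.diagram A))

theorem chartι_comp {A B : Δ.cones} (h : A.1 ⊆ B.1) :
    Spec.map (CommRingCat.ofHom (chartMap h)) ≫ Δ.chartι B = Δ.chartι A :=
  colimit.w Δ.diagram (homOfLE h : A ⟶ B)

theorem chartι_structureMorphism (A : Δ.cones) : Δ.chartι A ≫ Δ.structureMorphism =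
    Spec.map (CommRingCat.ofHom (algebraMap ℂ (ChartRing A.1))) :=
  colimit.ι_desc _ _

theorem exists_chartι_eq (x : Δ.toricVariety) :
    ∃ (A : Δ.cones) (p : PrimeSpectrum (ChartRing A.1)), Δ.chartι A p = x :=
  Scheme.IsLocallyDirected.ι_jointly_surjective Δ.diagram x

theorem exists_chartι_eq_of_subset {A B : Δ.cones} (h : A.1 ⊆ B.1)
    (p : PrimeSpectrum (ChartRing A.1)) :
    ∃ q : PrimeSpectrum (ChartRing B.1), Δ.chartι B q = Δ.chartι A p :=
  ⟨PrimeSpectrum.comap (chartMap h) p, by rw [← Δ.chartι_comp h]; rfl⟩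

/-- The cone `{0}`, whose chart is the torus. -/
def zeroCone : Δ.cones := ⟨∅, by
  obtain ⟨A, hA⟩ := Δ.nonempty_cones
  exact Δ.face_mem A hA _ (Finset.empty_subset _)⟩

/-- The toric variety is quasi-compact: it is covered by finitely many affine charts. -/
theorem compactSpace_toricVariety : CompactSpace Δ.toricVariety := by
  have : Finite Δ.cones := Δ.finite_cones
  have hcov : (⋃ A : Δ.cones, Set.range (Δ.chartι A)) = Set.univ := by
    rw [Set.eq_univ_iff_forall]
    intro x
    obtain ⟨A, p, h⟩ := Δ.exists_chartι_eq x
    exact Set.mem_iUnion.2 ⟨A, p, h⟩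
  refine ⟨hcov ▸ isCompact_iUnion fun A => ?_⟩
  exact isCompact_range (Δ.chartι A).continuous

instance (A : Finset N) : Nontrivial (CommRingCat.of (ChartRing A)) :=
  inferInstanceAs (Nontrivial (ChartRing A))

/-- The function field of the toric variety is the fraction field of the coordinate ring `ℂ[M]` of
the torus, and its local rings are those of the affine charts. -/
theorem exists_isTorusField [IsIntegral Δ.toricVariety] :
    letI : Algebra ℂ Δ.toricVariety.functionField :=
      (structureMapFunctionField Δ.structureMorphism).toAlgebra
    ∃ Φ : AddMonoidAlgebra ℂ (Dual ℤ N) →ₐ[ℂ] Δ.toricVariety.functionField, IsTorusField Φ ∧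
      ∀ (A : Δ.cones) (p : PrimeSpectrum (ChartRing A.1)),
        IsChartLocalRing Φ A.1 p (localSubring Δ.toricVariety (Δ.chartι A p)) := by
  let _ : Algebra ℂ Δ.toricVariety.functionField :=
    (structureMapFunctionField Δ.structureMorphism).toAlgebra
  let O := Δ.zeroCone
  let θ : AddMonoidAlgebra ℂ (Dual ℤ N) →ₐ[ℂ] ChartRing O.1 :=
    AddMonoidAlgebra.mapDomainAlgHom ℂ ℂ
      ({ toFun := fun w => ⟨w, fun _ h => absurd h (Finset.notMem_empty _)⟩
         map_zero' := rfl
         map_add' := fun _ _ => rfl } : Dual ℤ N →+ dualMonoid (∅ : Finset N))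
  have hθ : ∀ a : ChartRing O.1, θ (chartToTorus O.1 a) = a := by
    intro a
    induction a using AddMonoidAlgebra.induction_linear with
    | zero => simp
    | add a b ha hb => rw [map_add, map_add, ha, hb]
    | single w c =>
      rw [chartToTorus_single]
      exact AddMonoidAlgebra.mapDomain_single
  have hθinj : Function.Injective θ :=
    AddMonoidAlgebra.mapDomain_injective fun v w h => congrArg Subtype.val h
  let Φ : AddMonoidAlgebra ℂ (Dual ℤ N) →ₐ[ℂ] Δ.toricVariety.functionField :=
    { toRingHom := (chartToFunctionField (Δ.chartι O)).comp θ.toRingHom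
      commutes' := fun c => by
        change chartToFunctionField (Δ.chartι O) (θ (algebraMap ℂ _ c)) = _
        rw [θ.commutes]
        exact structureMapFunctionField_eq (Δ.chartι O) Δ.structureMorphism _
          (Δ.chartι_structureMorphism O) c }
  have hΦ : ∀ (A : Δ.cones) (a : ChartRing A.1),
      Φ (chartToTorus A.1 a) = chartToFunctionField (Δ.chartι A) a := by
    intro A a
    have hA : O.1 ⊆ A.1 := Finset.empty_subset _
    rw [← chartToTorus_chartMap hA]
    change chartToFunctionField (Δ.chartι O) (θ (chartToTorus O.1 (chartMap hA a))) = _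
    rw [hθ]
    have hcomp := Δ.chartι_comp hA
    have hopen : IsOpenImmersion
        (Spec.map (CommRingCat.ofHom (chartMap hA)) ≫ Δ.chartι A) := by rw [hcomp]; infer_instance
    have := chartToFunctionField_comp (Δ.chartι A) (CommRingCat.ofHom (chartMap hA)) a
    simp only [hcomp] at this
    exact this
  refine ⟨Φ, ⟨(chartToFunctionField_injective _).comp hθinj, fun z => ?_⟩, fun A p z => ?_⟩
  · obtain ⟨a, b, rfl⟩ := exists_chartToFunctionField_div (Δ.chartι O) z
    exact ⟨chartToTorus O.1 a, chartToTorus O.1 b, by rw [hΦ, hΦ]⟩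
  · refine (mem_localSubring_chart_iff (Δ.chartι A) p z).trans ?_
    simp only [hΦ]

variable [Module.Free ℤ N] [Module.Finite ℤ N]

theorem isDomain_chartRing (A : Finset N) : IsDomain (ChartRing A) := by
  have := isDomain_torusRing N
  exact (chartToTorus_injective A).isDomain _

instance (A : Finset N) : IsDomain (CommRingCat.of (ChartRing A)) := isDomain_chartRing A

/-- The toric variety is integral: it is covered by integral charts, all of which contain the
torus. -/
theorem isIntegral_toricVariety : IsIntegral Δ.toricVariety := by
  have hred : AlgebraicGeometry.IsReduced Δ.toricVariety := by
    have : ∀ A : (Scheme.IsLocallyDirected.openCover Δ.diagram).I₀, AlgebraicGeometry.IsReduced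
        ((Scheme.IsLocallyDirected.openCover Δ.diagram).X A) := fun (A : Δ.cones) =>
      inferInstanceAs (AlgebraicGeometry.IsReduced (Spec (.of (ChartRing A.1))))
    exact IsReduced.of_openCover _ (Scheme.IsLocallyDirected.openCover Δ.diagram)
  have hirr : IrreducibleSpace Δ.toricVariety := by
    have hmem : ∀ U : Set Δ.toricVariety, IsOpen U → U.Nonempty →
        Δ.chartι Δ.zeroCone (⊥ : PrimeSpectrum (ChartRing Δ.zeroCone.1)) ∈ U := by
      rintro U hU ⟨x, hx⟩
      obtain ⟨A, p, rfl⟩ := Δ.exists_chartι_eq x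
      have hbot : (Δ.chartι A ⁻¹' U) (⊥ : PrimeSpectrum (ChartRing A.1)) :=
        ((PrimeSpectrum.le_iff_specializes ⊥ p).1 bot_le).mem_open
          (hU.preimage (Δ.chartι A).continuous) hx
      have hA : Δ.zeroCone.1 ⊆ A.1 := Finset.empty_subset _
      rw [← Δ.chartι_comp hA]
      have : PrimeSpectrum.comap (chartMap hA) ⊥ = ⊥ := by
        ext a
        exact map_eq_zero_iff _ (chartMap_injective hA)
      rw [← this] at hbot
      exact hbot
    exact
      { toNonempty := ⟨Δ.chartι Δ.zeroCone (⊥ : PrimeSpectrum (ChartRing Δ.zeroCone.1))⟩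
        isPreirreducible_univ := fun U V hU hV hU' hV' =>
          ⟨_, trivial, hmem U hU (hU'.mono Set.inter_subset_right),
            hmem V hV (hV'.mono Set.inter_subset_right)⟩ }
  exact isIntegral_of_irreducibleSpace_of_isReduced _

end NonsingularFan
end ToricFano

namespace ToricFano

open CategoryTheory CategoryTheory.Limits AlgebraicGeometry Module

/-! ### The numerical criterion for the ampleness of the anticanonical bundle -/

namespace NonsingularFan

section Denominators

variable {N : Type} [AddCommGroup N] {K : Type} [Field K] [Algebra ℂ K]
  {Φ : AddMonoidAlgebra ℂ (Dual ℤ N) →ₐ[ℂ] K} {A : Finset N}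
  {O : PrimeSpectrum (ChartRing A) → Subring K}

theorem exists_pow_mul_eq_of_forall_mem (hO : ∀ p, IsChartLocalRing Φ A p (O p)) {h : K}
    {f : ChartRing A} (hf : ∀ p, f ∉ p.asIdeal → h ∈ O p) :
    ∃ k : ℕ, ∃ a, Φ (chartToTorus A f) ^ k * h = Φ (chartToTorus A a) :=
  exists_pow_mul_eq_map ((Φ : AddMonoidAlgebra ℂ (Dual ℤ N) →+* K).comp (chartToTorus A))
    fun p hp => ((hO p) h).1 (hf p hp)

theorem exists_eq_of_forall_mem (hO : ∀ p, IsChartLocalRing Φ A p (O p)) {h : K}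
    (hf : ∀ p, h ∈ O p) : ∃ a, Φ (chartToTorus A a) = h := by
  obtain ⟨k, a, ha⟩ := exists_pow_mul_eq_of_forall_mem hO (f := 1) fun p _ => hf p
  exact ⟨a, by rw [← ha, map_one, map_one, one_pow, one_mul]⟩

end Denominators

variable {N : Type} [AddCommGroup N] {Δ : NonsingularFan N}

theorem exists_maximal_chartι_eq (x : Δ.toricVariety) :
    ∃ A : Δ.cones, Maximal (fun A => A ∈ Δ.cones) A.1 ∧
      ∃ p : PrimeSpectrum (ChartRing A.1), Δ.chartι A p = x := by
  obtain ⟨A, p, rfl⟩ := Δ.exists_chartι_eq x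
  obtain ⟨B, hB, hAB⟩ := exists_maximal_of_mem A.2
  exact ⟨⟨B, hB.prop⟩, hB, Δ.exists_chartι_eq_of_subset (B := ⟨B, hB.prop⟩) hAB p⟩

/-- A section of a power of the anticanonical bundle has a local equation on the chart of each
maximal cone. -/
theorem IsStarComplete.exists_local_equation (hΔ : Δ.IsStarComplete) [IsIntegral Δ.toricVariety]
    [Algebra ℂ Δ.toricVariety.functionField]
    {Φ : AddMonoidAlgebra ℂ (Dual ℤ N) →ₐ[ℂ] Δ.toricVariety.functionField} (hΦ : IsTorusField Φ)
    {B : Δ.cones} (hloc : ∀ q : PrimeSpectrum (ChartRing B.1),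
      IsChartLocalRing Φ B.1 q (localSubring Δ.toricVariety (Δ.chartι B q)))
    {ι : Type} [Fintype ι] (e₀ : Basis ι ℤ N)
    (ε₀ : Fin (finrank Δ.toricVariety.functionField Ω[Δ.toricVariety.functionField⁄ℂ]) ≃ ι)
    {m : ℕ} {s : RationalAnticanonicalSection ℂ Δ.toricVariety.functionField m}
    (hreg : ∀ y : Δ.toricVariety, IsRegularAt s (localSubring Δ.toricVariety y))
    (hB : Maximal (fun A => A ∈ Δ.cones) B.1) {v : Dual ℤ N} (hv : ∀ ρ ∈ B.1, v ρ = 1) :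
    ∃ b : ChartRing B.1,
      Φ (chartToTorus B.1 b) = character Φ (m • v) * s (fun _ => logForm Φ e₀ ε₀) ∧
      ∀ q : PrimeSpectrum (ChartRing B.1),
        IsNonvanishingAt s (localSubring Δ.toricVariety (Δ.chartι B q)) ↔ b ∉ q.asIdeal := by
  obtain ⟨e, he⟩ := hΔ.exists_basis hB
  have key := fun q => (hloc q).isRegularAt_and_isNonvanishingAt_iff hΦ e he hv e₀ ε₀ s
  obtain ⟨b, hb⟩ := exists_eq_of_forall_mem hloc fun q => (key q).1.1 (hreg _)
  refine ⟨b, hb, fun q => ?_⟩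
  rw [(key q).2 (hreg _), ← hb]
  rcases eq_or_ne b 0 with rfl | h0
  · simp
  · rw [(hloc q).inv_mem_iff hΦ h0]
    exact and_iff_right (hΦ.map_chart_ne_zero h0)

variable [Module.Free ℤ N] [Module.Finite ℤ N]

/-- The character `χ^(-u)`, for the functional `u` that is `1` on a maximal cone, is a section of
the anticanonical bundle, and its nonvanishing locus is the chart of that cone. -/
theorem IsStarComplete.isFano_of_isNumericallyFano (hΔ : Δ.IsStarComplete)
    (hF : Δ.IsNumericallyFano) : IsFano Δ.structureMorphism := by
  classical
  have hint := Δ.isIntegral_toricVariety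
  let _ : Algebra ℂ Δ.toricVariety.functionField :=
    (structureMapFunctionField Δ.structureMorphism).toAlgebra
  obtain ⟨Φ, hΦ, hloc⟩ := Δ.exists_isTorusField
  let e₀ := Module.Free.chooseBasis ℤ N
  obtain ⟨ε₀, -⟩ := hΦ.exists_equiv_basis e₀
  obtain ⟨l, hl⟩ := hΦ.exists_dual_logForm_eq_one e₀ (ε := ε₀)
  refine ⟨hint, Δ.compactSpace_toricVariety, fun x => ?_⟩
  obtain ⟨A, hA, p, rfl⟩ := exists_maximal_chartι_eq x
  obtain ⟨u, hu⟩ := exists_dual_eq A.2 fun _ => 1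
  have hle : ∀ ρ ∈ Δ.rays, ρ ∉ A.1 → u ρ ≤ 0 := hF A.1 hA u hu
  let s : RationalAnticanonicalSection ℂ Δ.toricVariety.functionField 1 :=
    (MultilinearMap.mkPiAlgebra Δ.toricVariety.functionField (Fin 1)
      Δ.toricVariety.functionField).compLinearMap fun _ => character Φ (-u) • l
  have hs : s (fun _ => logForm Φ e₀ ε₀) = character Φ (-u) := by
    simp [s, hl]
  have key : ∀ (B : Δ.cones), Maximal (fun A => A ∈ Δ.cones) B.1 → ∀ (v : Dual ℤ N),
      (∀ ρ ∈ B.1, v ρ = 1) → v - u ∈ dualMonoid B.1 ∧ ∀ q : PrimeSpectrum (ChartRing B.1),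
        IsRegularAt s (localSubring Δ.toricVariety (Δ.chartι B q)) ∧
        (IsNonvanishingAt s (localSubring Δ.toricVariety (Δ.chartι B q)) ↔
          (character Φ (v - u))⁻¹ ∈ localSubring Δ.toricVariety (Δ.chartι B q)) := by
    intro B hB v hv
    have hmem : v - u ∈ dualMonoid B.1 := by
      intro ρ hρ
      rw [LinearMap.sub_apply, hv ρ hρ]
      by_cases hρA : ρ ∈ A.1
      · rw [hu ρ hρA, sub_self]
      · have := hle ρ (mem_rays_of_mem B.2 hρ) hρA
        omega
    refine ⟨hmem, fun q => ?_⟩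
    obtain ⟨e, he⟩ := hΔ.exists_basis hB
    obtain ⟨h1, h2⟩ := (hloc B q).isRegularAt_and_isNonvanishingAt_iff hΦ e he hv e₀ ε₀ s
    rw [hs, one_smul, ← character_add, ← sub_eq_add_neg] at h1 h2
    have hreg := h1.2 ((hloc B q).character_mem hmem)
    exact ⟨hreg, (h2 hreg).trans ⟨fun h => h.2, fun h => ⟨character_ne_zero _, h⟩⟩⟩
  have hchart : ∀ q : PrimeSpectrum (ChartRing A.1),
      IsNonvanishingAt s (localSubring Δ.toricVariety (Δ.chartι A q)) := by
    intro q
    rw [((key A hA u hu).2 q).2, sub_self, character_zero, inv_one]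
    exact one_mem _
  refine ⟨1, le_rfl, s, fun y => ?_, hchart p, (Δ.chartι A).opensRange, fun y => ?_,
    isAffineOpen_opensRange _⟩
  · obtain ⟨B, hB, q, rfl⟩ := exists_maximal_chartι_eq y
    obtain ⟨v, hv⟩ := exists_dual_eq B.2 fun _ => 1
    exact ((key B hB v hv).2 q).1
  · constructor
    · rintro ⟨q, rfl⟩
      exact hchart q
    · intro hy
      obtain ⟨B, hB, q, rfl⟩ := exists_maximal_chartι_eq y
      obtain ⟨v, hv⟩ := exists_dual_eq B.2 fun _ => 1
      obtain ⟨hmem, hq⟩ := key B hB v hv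
      rw [(hq q).2] at hy
      have hchar : character Φ (v - u) =
          Φ (chartToTorus B.1 (AddMonoidAlgebra.single ⟨v - u, hmem⟩ 1)) := by
        rw [chartToTorus_single, character]
      have hne : (AddMonoidAlgebra.single ⟨v - u, hmem⟩ 1 : ChartRing B.1) ≠ 0 := by
        simp
      rw [hchar, (hloc B q).inv_mem_iff hΦ hne] at hy
      let C : Δ.cones := ⟨A.1 ∩ B.1, Δ.face_mem _ A.2 _ Finset.inter_subset_left⟩
      have hCA : C.1 ⊆ A.1 := Finset.inter_subset_left
      have hCB : C.1 ⊆ B.1 := Finset.inter_subset_right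
      have hrange : q ∈ Set.range (chartInclusion hCB) := by
        rw [range_chartInclusion hCB ⟨v - u, hmem⟩]
        · exact hy
        · intro ρ hρ
          change v ρ - u ρ = 0
          rw [hv ρ (hCB hρ), hu ρ (hCA hρ), sub_self]
        · intro ρ hρ hρC
          have hρA : ρ ∉ A.1 := fun h => hρC (Finset.mem_inter.2 ⟨h, hρ⟩)
          have := hle ρ (mem_rays_of_mem B.2 hρ) hρA
          change 1 ≤ v ρ - u ρ
          rw [hv ρ hρ]
          omega
      obtain ⟨r, hr⟩ := hrange
      obtain ⟨r', hr'⟩ := Δ.exists_chartι_eq_of_subset (A := C) hCA r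
      refine ⟨r', hr'.trans ?_⟩
      rw [← Δ.chartι_comp (A := C) hCB, ← hr]
      rfl

/-- The local equation of a section at the fixed point of a cone `μ` bounds its order along the
divisor of a ray `ρ`, which gives `u ρ ≤ 1`.  In the case of equality the open set where the section
does not vanish contains the generic point of that divisor along with the fixed point, and functions
that are regular on this affine set would not separate the two. -/
theorem IsStarComplete.isNumericallyFano_of_isFano (hΔ : Δ.IsStarComplete)
    (h : IsFano Δ.structureMorphism) : Δ.IsNumericallyFano := by
  classical
  obtain ⟨hint, -, h⟩ := h
  let _ : Algebra ℂ Δ.toricVariety.functionField :=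
    (structureMapFunctionField Δ.structureMorphism).toAlgebra
  obtain ⟨Φ, hΦ, hloc⟩ := Δ.exists_isTorusField
  let e₀ := Module.Free.chooseBasis ℤ N
  obtain ⟨ε₀, -⟩ := hΦ.exists_equiv_basis e₀
  intro μ hμ u hu ρ hρ hρμ
  let A : Δ.cones := ⟨μ, hμ.prop⟩
  obtain ⟨B₀, hB, hρB⟩ := exists_maximal_of_mem hρ
  let B : Δ.cones := ⟨B₀, hB.prop⟩
  obtain ⟨v, hv⟩ := exists_dual_eq B.2 fun _ => 1
  have hvρ : v ρ = 1 := hv ρ (hρB (Finset.mem_singleton_self ρ))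
  let pA : PrimeSpectrum (ChartRing A.1) := facePoint (Finset.Subset.refl A.1)
  let pρ : PrimeSpectrum (ChartRing B.1) := facePoint hρB
  have hA : ∀ w : Dual ℤ N, (∀ ρ ∈ A.1, w ρ = 0) → w = 0 := by
    intro w hw
    obtain ⟨e, he⟩ := hΔ.exists_basis hμ
    exact e.ext fun i => by rw [he, hw _ i.2, LinearMap.zero_apply]
  obtain ⟨m, hm, s, hreg, hnv, U, hU, hUaff⟩ := h (Δ.chartι A pA)
  set g := s fun _ => logForm Φ e₀ ε₀
  obtain ⟨a, ha, hnva⟩ := hΔ.exists_local_equation hΦ (hloc A) e₀ ε₀ hreg hμ hu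
  obtain ⟨b, hb, hnvb⟩ := hΔ.exists_local_equation hΦ (hloc B) e₀ ε₀ hreg hB hv
  have hapA : a ∉ pA.asIdeal := (hnva pA).1 hnv
  have hcoeff := hΦ.coeff_ne_zero_of_notMem hA ha hb hapA
  have hle := mem_dualMonoid_of_coeff_ne_zero hcoeff ρ (hρB (Finset.mem_singleton_self ρ))
  have hval : ∀ l : ℕ, (l • (v - u)) ρ = l * (1 - u ρ) := by
    intro l
    rw [LinearMap.smul_apply, LinearMap.sub_apply, hvρ, nsmul_eq_mul]
  rw [hval] at hle
  have hm0 : (0 : ℤ) < m := by exact_mod_cast hm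
  have hle1 : 0 ≤ 1 - u ρ := nonneg_of_mul_nonneg_right hle hm0
  by_contra! hpos
  have hval0 : ∀ l : ℕ, ∀ ρ' ∈ ({ρ} : Finset N), (l • (v - u)) ρ' = 0 := by
    intro l ρ' hρ'
    obtain rfl := Finset.mem_singleton.1 hρ'
    rw [hval, show 1 - u ρ' = 0 by omega, mul_zero]
  obtain ⟨w, hw, hwρ⟩ := hΔ.exists_dual_neg hμ hρ hρμ
  refine (hloc B pρ).character_notMem hΦ hρB hwρ ?_
  obtain ⟨h₁, h₂, hh₁, hh₂, h0, hinv, hfrac⟩ := exists_regular_fraction hUaff ((hU _).2 hnv)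
    ((hloc A pA).character_mem hw)
  obtain ⟨k₁, a₁, ha₁⟩ := exists_pow_mul_eq_of_forall_mem (hloc A) (f := a)
    fun p hp => hh₂ _ ((hU _).2 ((hnva p).2 hp))
  obtain ⟨k₂, b₁, hb₁⟩ := exists_pow_mul_eq_of_forall_mem (hloc B) (f := b)
    fun p hp => hh₂ _ ((hU _).2 ((hnvb p).2 hp))
  have hbρ : b ∉ pρ.asIdeal := (notMem_facePoint_iff hρB).2 ⟨_, hval0 m, hcoeff⟩
  -- The function `h₂` times the `k`-th power of the section is again a section, now of the power
  -- `k * m`, with local equations `a ^ k₂ * a₁` and `b ^ k₁ * b₁`.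
  let k := k₁ + k₂
  have ha' : Φ (chartToTorus A.1 (a ^ k₂ * a₁)) = Φ (chartToTorus A.1 a) ^ k * h₂ := by
    rw [map_mul, map_mul, ← ha₁, map_pow, map_pow, pow_add]
    ring
  have hb' : Φ (chartToTorus B.1 (b ^ k₁ * b₁)) = Φ (chartToTorus B.1 b) ^ k * h₂ := by
    rw [map_mul, map_mul, ← hb₁, map_pow, map_pow, pow_add]
    ring
  have hpow : ∀ (t : Dual ℤ N), (character Φ (m • t) * g) ^ k * h₂ =
      character Φ ((k * m) • t) * (g ^ k * h₂) := by
    intro t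
    rw [mul_smul, character_nsmul k, mul_pow, mul_assoc]
  have hne : ∀ {C : Finset N} {c d : ChartRing C}, c ≠ 0 →
      Φ (chartToTorus C d) = Φ (chartToTorus C c) ^ k * h₂ → d ≠ 0 := by
    rintro C c d hc hd rfl
    rw [map_zero, map_zero] at hd
    exact mul_ne_zero (pow_ne_zero _ (hΦ.map_chart_ne_zero hc)) h0 hd.symm
  have ha'pA : a ^ k₂ * a₁ ∉ pA.asIdeal := by
    rw [← (hloc A pA).inv_mem_iff hΦ (hne (ne_zero_of_notMem hapA) ha'), ha', mul_inv, ← inv_pow]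
    exact mul_mem (pow_mem (((hloc A pA).inv_mem_iff hΦ (ne_zero_of_notMem hapA)).2 hapA) _) hinv
  have hb'ρ : b ^ k₁ * b₁ ∉ pρ.asIdeal := by
    refine (notMem_facePoint_iff hρB).2 ⟨_, hval0 (k * m), ?_⟩
    refine hΦ.coeff_ne_zero_of_notMem hA (z := g ^ k * h₂) ?_ ?_ ha'pA
    · rw [ha', ha, hpow]
    · rw [hb', hb, hpow]
  have hηU : Δ.chartι B pρ ∈ U := (hU _).2 ((hnvb pρ).2 hbρ)
  have hinvρ : h₂⁻¹ ∈ localSubring Δ.toricVariety (Δ.chartι B pρ) := by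
    have hb0 := pow_ne_zero k (hΦ.map_chart_ne_zero (ne_zero_of_notMem hbρ))
    have heq : h₂⁻¹ = Φ (chartToTorus B.1 b) ^ k * (Φ (chartToTorus B.1 (b ^ k₁ * b₁)))⁻¹ := by
      rw [hb', mul_inv, mul_inv_cancel_left₀ hb0]
    rw [heq]
    exact mul_mem (pow_mem ((hloc B pρ).map_mem b) k)
      (((hloc B pρ).inv_mem_iff hΦ (ne_zero_of_notMem hb'ρ)).2 hb'ρ)
  rw [hfrac]
  exact mul_mem (hh₁ _ hηU) hinvρ

end NonsingularFan
end ToricFano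

namespace ToricFano

open Module

/-! ### The Fano condition in terms of the fan -/

namespace NonsingularFan

variable {N : Type} [AddCommGroup N] {Δ : NonsingularFan N}

theorem IsStarComplete.isFano_iff_isNumericallyFano [Module.Free ℤ N] [Module.Finite ℤ N]
    (hΔ : Δ.IsStarComplete) : IsFano Δ.structureMorphism ↔ Δ.IsNumericallyFano :=
  ⟨hΔ.isNumericallyFano_of_isFano, hΔ.isFano_of_isNumericallyFano⟩

theorem IsStarComplete.isFano_starFan_iff_isFanoAlong [Module.Finite ℤ N]
    (hΔ : Δ.IsStarComplete) {σ : Finset N} (hσ : σ ∈ Δ.cones) :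
    IsFano (Δ.starFan σ hσ).structureMorphism ↔ Δ.IsFanoAlong σ := by
  obtain ⟨ι, b, hb⟩ := Δ.part_of_basis σ hσ
  obtain ⟨b', -⟩ := exists_basis_quotient (σ : Set N) b hb
  have := Module.Free.of_basis b'
  rw [(hΔ.starFan hσ).isFano_iff_isNumericallyFano, isNumericallyFano_starFan_iff]

end NonsingularFan
end ToricFano

theorem mainTheorem4 {N : Type} [AddCommGroup N] [Module.Free ℤ N] [Module.Finite ℤ N]
    (Δ : ToricFano.NonsingularFan N) (hΔ : Δ.IsComplete) :
    [ -- the toric variety and all its toric subvarieties are Fano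
      ToricFano.IsFano Δ.structureMorphism ∧
        ∀ (σ : Finset N) (hσ : σ ∈ Δ.cones), ToricFano.IsFano (Δ.starFan σ hσ).structureMorphism,
      -- the primitive relations
      ∀ P : Finset N, Δ.IsPrimitiveSet P → ∑ ρ ∈ P, ρ = 0 ∨ ∃ ρ' ∈ Δ.rays, ∑ ρ ∈ P, ρ = ρ',
      -- the coordinates of ray generators with respect to maximal cones
      ∀ μ : Finset N, Maximal (fun A => A ∈ Δ.cones) μ → ∀ ρ ∈ Δ.rays,
        ∃ b : N → ℤ, ρ = ∑ v ∈ μ, b v • v ∧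
          (∀ v ∈ μ, -1 ≤ b v ∧ b v ≤ 1) ∧
          ∀ v ∈ μ, ∀ w ∈ μ, b v = 1 → b w = 1 → v = w ].TFAE := by
  have hS := hΔ.isStarComplete
  have h32 : Δ.HasSmallCoordinates → Δ.HasSmallPrimitiveSums := fun h =>
    h.hasSmallPrimitiveSums hS
  have h23 : Δ.HasSmallPrimitiveSums → Δ.HasSmallCoordinates := fun h =>
    ToricFano.NonsingularFan.hasSmallCoordinates_of_raysReduceModulo hS fun _ hσ =>
      h.raysReduceModulo hσ
  tfae_have 1 → 3 := fun h =>
    ToricFano.NonsingularFan.hasSmallCoordinates_of_raysReduceModulo hS fun _ hσ =>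
      ToricFano.NonsingularFan.raysReduceModulo_of_isFanoAlong hS
        (fun σ hσ => (hS.isFano_starFan_iff_isFanoAlong hσ).1 (h.2 σ hσ)) hσ
  tfae_have 3 → 1 := fun h =>
    have hF := fun σ => ToricFano.NonsingularFan.HasSmallCoordinates.isFanoAlong (σ := σ) h
    ⟨hS.isFano_iff_isNumericallyFano.2
        (ToricFano.NonsingularFan.isNumericallyFano_of_isFanoAlong_empty (hF ∅)),
      fun σ hσ => (hS.isFano_starFan_iff_isFanoAlong hσ).2 (hF σ)⟩
  tfae_have 3 → 2 := h32
  tfae_have 2 → 3 := h23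
  tfae_finish
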